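/- **Theorem (Best low rank approximation).** Let $\mathbb{Q}$ be the real quaternions, $m\ge 1$, and $\breve{\mathcal T}\in\mathbb{Q}^{n_1\times n_2\times m}$ with frontal slices indexed by $t\in\mathbb{Z}/m$. Let $\mathrm{bcirc}(\breve{\mathcal T})$ be the block circulant matrix whose $(s,t)$ block is the slice of index $s-t$, let $\breve{\mathcal X}\star\breve{\mathcal Y}=\mathrm{fold}(\mathrm{bcirc}(\breve{\mathcal X})\,\mathrm{unfold}(\breve{\mathcal Y}))$ be the t-product, let $\breve{\mathcal X}^*$ have as $t$-th slice the conjugate transpose of the $(-t)$-th slice of $\breve{\mathcal X}$, and let $\|\cdot\|_F$ be the Frobenius norm. Fix a pure quaternion $\mu$ with $|\mu|=1$, and let $F$ be the $m\times m$ matrix $F_{uv}=m^{-1/2}\exp(-2\pi\mu/m)^{uv}$, $0\le u,v<m$. Put $\breve D=(F\otimes I_{n_1})\,\mathrm{bcirc}(\breve{\mathcal T})\,(F^*\otimes I_{n_2})$, with $n_1\times n_2$ blocks $\breve D_{s,t}$. Define $$G_t=\breve D_{t,t}\ \text{ if } t=-t \text{ in } \mathbb{Z}/m,\qquad G_t=\begin{pmatrix}\breve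 D_{t,t}&\breve D_{t,-t}\\ \breve D_{-t,t}&\breve D_{-t,-t}\end{pmatrix}\ \text{ for one representative } t \text{ of every pair } \{t,-t\},\ t\ne -t .$$ Let $0\le r<\min(n_1,n_2)$. A *truncated quaternion T-SVD* of $\breve{\mathcal T}$ is a triple $\breve{\mathcal U}^{[r]}\in\mathbb{Q}^{n_1\times r\times m}$, $\breve{\mathcal S}^{[r]}\in\mathbb{Q}^{r\times r\times m}$, $\breve{\mathcal V}^{[r]}\in\mathbb{Q}^{n_2\times r\times m}$ obtained as follows. Take quaternion singular value decompositions $G_t=U_t\Lambda_tV_t^*$ ($U_t,V_t$ unitary, $\Lambda_t$ real, rectangular diagonal, nonnegative) in which the first $r$ (if $t=-t$), respectively the first $2r$ (if $t\neq -t$), diagonal entries of $\Lambda_t$ are at least as large as the remaining ones. Let $U^{[r]}$, of size $mn_1\times mr$, be the block matrix with zero blocks except the following: if $t=-t$, its $(t,t)$ block is $U_t(:,1{:}r)$; if $t\ne-t$, its block rows $t,-t$ (in this order) and block columns $t,-t$ (in this order) form $U_t(:,1{:}2r)$. Let $V^{[r]}$ be built likewise from the $V_t$, and $\Sigma^{[r]}$,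 of size $mr\times mr$, likewise from $\Lambda_t(1{:}r,1{:}r)$, respectively $\Lambda_t(1{:}2r,1{:}2r)$. The three tensors are required to satisfy $$\mathrm{bcirc}(\breve{\mathcal U}^{[r]})=(F^*\otimes I_{n_1})U^{[r]}(F\otimes I_r),\quad \mathrm{bcirc}(\breve{\mathcal S}^{[r]})=(F^*\otimes I_r)\Sigma^{[r]}(F\otimes I_r),\quad \mathrm{bcirc}(\breve{\mathcal V}^{[r]})=(F^*\otimes I_{n_2})V^{[r]}(F\otimes I_r).$$ Then: 1. There is a quaternion T-SVD $\breve{\mathcal T}=\breve{\mathcal U}\star\breve{\mathcal S}\star\breve{\mathcal V}^*$, with $\breve{\mathcal U}\in\mathbb{Q}^{n_1\times n_1\times m}$ and $\breve{\mathcal V}\in\mathbb{Q}^{n_2\times n_2\times m}$ unitary (i.e. $\breve{\mathcal U}^*\star\breve{\mathcal U}=\breve{\mathcal U}\star\breve{\mathcal U}^*=\mathcal I$, where $\mathcal I$ has slice $I$ at index $0$ and zero slices elsewhere, and likewise for $\breve{\mathcal V}$) and all frontal slices of $\breve{\mathcal S}$ diagonal, such that for every $r<\min(n_1,n_2)$ the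 tensors $\breve{\mathcal U}(:,1{:}r,:)$, $\breve{\mathcal S}(1{:}r,1{:}r,:)$, $\breve{\mathcal V}(:,1{:}r,:)$ form a truncated quaternion T-SVD of $\breve{\mathcal T}$. 2. For every $r<\min(n_1,n_2)$ and every truncated quaternion T-SVD of $\breve{\mathcal T}$, the tensor $\breve{\mathcal T}^{[r]}=\breve{\mathcal U}^{[r]}\star\breve{\mathcal S}^{[r]}\star(\breve{\mathcal V}^{[r]})^*$ belongs to $$\Omega=\{\breve{\mathcal X}\star\breve{\mathcal Y}:\ \breve{\mathcal X}\in\mathbb{Q}^{n_1\times r\times m},\ \breve{\mathcal Y}\in\mathbb{Q}^{r\times n_2\times m}\}$$ and minimizes $\|\breve{\mathcal T}-\breve{\mathcal Z}\|_F^2$ over $\breve{\mathcal Z}\in\Omega$. -/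

import Mathlib

open scoped Matrix Kronecker

noncomputable section

/-- Third-order quaternion tensors of size `n₁ × n₂ × m`; `T i j k` is the `(i, j)` entry of the
`k`-th frontal slice. The index `k` starts from `0` and is read modulo `m`. -/
abbrev QTensor (n₁ n₂ m : ℕ) : Type := Fin n₁ → Fin n₂ → Fin m → Quaternion ℝ

namespace QTensor

/-- The block circulant matrix: its `(s, t)` block is the frontal slice of index `s - t` modulo `m`. -/
def bcirc {n₁ n₂ m : ℕ} (T : QTensor n₁ n₂ m) :
    Matrix (Fin m × Fin n₁) (Fin m × Fin n₂) (Quaternion ℝ) :=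
  Matrix.of fun a b => T a.2 b.2 (a.1 - b.1)

/-- The frontal slices stacked in one block column. -/
def unfold {n₁ n₂ m : ℕ} (T : QTensor n₁ n₂ m) :
    Matrix (Fin m × Fin n₁) (Fin n₂) (Quaternion ℝ) :=
  Matrix.of fun a j => T a.2 j a.1

/-- The inverse of `unfold`. -/
def fold {n₁ n₂ m : ℕ} (A : Matrix (Fin m × Fin n₁) (Fin n₂) (Quaternion ℝ)) : QTensor n₁ n₂ m :=
  fun i j k => A (k, i) j

/-- The t-product of quaternion tensors. -/
def tProd {n₁ n₂ n₃ m : ℕ} (T : QTensor n₁ n₂ m) (B : QTensor n₂ n₃ m) : QTensor n₁ n₃ m :=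
  fold (bcirc T * unfold B)

/-- Conjugate transpose: every frontal slice is conjugate transposed, and the order of all slices
but the first one is reversed. -/
def conjT {n₁ n₂ m : ℕ} [NeZero m] (T : QTensor n₁ n₂ m) : QTensor n₂ n₁ m :=
  fun i j k => star (T j i (-k))

/-- The identity tensor. -/
def idTensor (n m : ℕ) [NeZero m] : QTensor n n m :=
  fun i j k => if k = 0 ∧ i = j then 1 else 0

/-- Unitary tensors. -/
def IsUnitary {n m : ℕ} [NeZero m] (Q : QTensor n n m) : Prop :=
  tProd (conjT Q) Q = idTensor n m ∧ tProd Q (conjT Q) = idTensor n m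

/-- Tensors all of whose frontal slices are (rectangular) diagonal matrices. -/
def IsDiagonal {n₁ n₂ m : ℕ} (S : QTensor n₁ n₂ m) : Prop :=
  ∀ i j k, i.val ≠ j.val → S i j k = 0

/-- The Frobenius norm of a quaternion tensor. -/
def frobNorm {n₁ n₂ m : ℕ} (T : QTensor n₁ n₂ m) : ℝ :=
  Real.sqrt (∑ i, ∑ j, ∑ k, ‖T i j k‖ ^ 2)

/-- `T = U ⋆ S ⋆ V^*` is a quaternion tensor singular value decomposition of `T`. -/
def IsQTSVD {n₁ n₂ m : ℕ} [NeZero m] (T : QTensor n₁ n₂ m)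
    (U : QTensor n₁ n₁ m) (S : QTensor n₁ n₂ m) (V : QTensor n₂ n₂ m) : Prop :=
  IsUnitary U ∧ IsUnitary V ∧ IsDiagonal S ∧ T = tProd (tProd U S) (conjT V)

/-- The first `r` lateral slices `T(:, 1:r, :)`. -/
def firstCols {n₁ n₂ m r : ℕ} (h : r ≤ n₂) (T : QTensor n₁ n₂ m) : QTensor n₁ r m :=
  fun i j k => T i (Fin.castLE h j) k

/-- The leading part `T(1:r, 1:r, :)`. -/
def leading {n₁ n₂ m r : ℕ} (h₁ : r ≤ n₁) (h₂ : r ≤ n₂) (T : QTensor n₁ n₂ m) : QTensor r r m :=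
  fun i j k => T (Fin.castLE h₁ i) (Fin.castLE h₂ j) k

/-- The set of the tensors `X ⋆ Y` with `X` of size `n₁ × r × m` and `Y` of size `r × n₂ × m`. -/
def lowRank (n₁ n₂ m r : ℕ) : Set (QTensor n₁ n₂ m) :=
  {Z | ∃ (X : QTensor n₁ r m) (Y : QTensor r n₂ m), Z = tProd X Y}

/-- Pure quaternions of modulus one. -/
def IsUnitPure (μ : Quaternion ℝ) : Prop := μ.re = 0 ∧ ‖μ‖ = 1

/-- The discrete quaternion Fourier transform matrix
`[F_μ]_{uv} = m^{-1/2} exp(-2 π μ / m)^{uv}`, `u, v = 0, …, m - 1`. -/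
def qft (m : ℕ) (μ : Quaternion ℝ) : Matrix (Fin m) (Fin m) (Quaternion ℝ) :=
  Matrix.of fun u v => (1 / Real.sqrt m : ℝ) •
    (NormedSpace.exp ((-2 * Real.pi / m : ℝ) • μ)) ^ (u.val * v.val)

/-- The Fourier transform `(F_μ ⊗ I) A (F_μ^* ⊗ I)` of a block matrix. -/
def toFourier {m a b : ℕ} (μ : Quaternion ℝ)
    (A : Matrix (Fin m × Fin a) (Fin m × Fin b) (Quaternion ℝ)) :
    Matrix (Fin m × Fin a) (Fin m × Fin b) (Quaternion ℝ) :=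
  (qft m μ ⊗ₖ (1 : Matrix (Fin a) (Fin a) (Quaternion ℝ))) * A *
    ((qft m μ)ᴴ ⊗ₖ (1 : Matrix (Fin b) (Fin b) (Quaternion ℝ)))

/-- The inverse transform `(F_μ^* ⊗ I) A (F_μ ⊗ I)`. -/
def fromFourier {m a b : ℕ} (μ : Quaternion ℝ)
    (A : Matrix (Fin m × Fin a) (Fin m × Fin b) (Quaternion ℝ)) :
    Matrix (Fin m × Fin a) (Fin m × Fin b) (Quaternion ℝ) :=
  ((qft m μ)ᴴ ⊗ₖ (1 : Matrix (Fin a) (Fin a) (Quaternion ℝ))) * A *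
    (qft m μ ⊗ₖ (1 : Matrix (Fin b) (Fin b) (Quaternion ℝ)))

/-- The `(s, t)` block of a block matrix. -/
def block {m a b : ℕ} (A : Matrix (Fin m × Fin a) (Fin m × Fin b) (Quaternion ℝ))
    (s t : Fin m) : Matrix (Fin a) (Fin b) (Quaternion ℝ) :=
  Matrix.of fun i j => A (s, i) (t, j)

/-- The diagonal block `G_t` of the Fourier transform of `bcirc T`; used at the frequencies
with `t = -t` modulo `m`. -/
def singleBlock {n₁ n₂ m : ℕ} (μ : Quaternion ℝ) (T : QTensor n₁ n₂ m) (t : Fin m) :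
    Matrix (Fin n₁) (Fin n₂) (Quaternion ℝ) :=
  block (toFourier μ (bcirc T)) t t

/-- The `2 n₁ × 2 n₂` block `G_t` of the Fourier transform of `bcirc T` that collects the block rows
and the block columns of index `t` and `-t` modulo `m`; used when `t < -t`. -/
def pairBlock {n₁ n₂ m : ℕ} [NeZero m] (μ : Quaternion ℝ) (T : QTensor n₁ n₂ m) (t : Fin m) :
    Matrix (Fin n₁ ⊕ Fin n₁) (Fin n₂ ⊕ Fin n₂) (Quaternion ℝ) :=
  Matrix.fromBlocks
    (block (toFourier μ (bcirc T)) t t) (block (toFourier μ (bcirc T)) t (-t))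
    (block (toFourier μ (bcirc T)) (-t) t) (block (toFourier μ (bcirc T)) (-t) (-t))

/-- The rectangular diagonal `p × q` matrix with diagonal `σ`. -/
def rectDiag {p q : ℕ} (σ : Fin (min p q) → ℝ) : Matrix (Fin p) (Fin q) (Quaternion ℝ) :=
  Matrix.of fun i j =>
    if h : i.val = j.val then ((σ ⟨i.val, lt_min i.isLt (h ▸ j.isLt)⟩ : ℝ) : Quaternion ℝ) else 0

/-- A quaternion singular value decomposition `U^* M V = Σ` in which the first `c` singular values
are `c` largest ones, so that keeping the first `c` components is a truncated SVD. -/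
structure IsQSVD {ι κ : Type} [Fintype ι] [Fintype κ] [DecidableEq ι] [DecidableEq κ] {p q : ℕ}
    (c : ℕ) (M : Matrix ι κ (Quaternion ℝ)) (U : Matrix ι (Fin p) (Quaternion ℝ))
    (σ : Fin (min p q) → ℝ) (V : Matrix κ (Fin q) (Quaternion ℝ)) : Prop where
  left_unitary : Uᴴ * U = 1 ∧ U * Uᴴ = 1
  right_unitary : Vᴴ * V = 1 ∧ V * Vᴴ = 1
  nonneg : ∀ k, 0 ≤ σ k
  svd : Uᴴ * M * V = rectDiag σ
  largest : ∀ k l, k.val < c → c ≤ l.val → σ l ≤ σ k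

/-- The truncated factor `U^{[r]}` assembled from the factors `U₁ t` of the single blocks (`t = -t`)
and the factors `U₂ t` of the pair blocks (`t < -t`). It keeps the first `r` columns of `U₁ t`, put
into the block column `t`, and the first `2 r` columns of `U₂ t`, of which the columns `1:r` go to
the block column `t` and the columns `r+1:2r` go to the block column `-t`. -/
def truncFactor {n m r : ℕ} [NeZero m] (h : r ≤ n)
    (U₁ : Fin m → Matrix (Fin n) (Fin n) (Quaternion ℝ))
    (U₂ : Fin m → Matrix (Fin n ⊕ Fin n) (Fin (2 * n)) (Quaternion ℝ)) :
    Matrix (Fin m × Fin n) (Fin m × Fin r) (Quaternion ℝ) :=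
  Matrix.of fun a b =>
    let s := a.1
    let i := a.2
    let t := b.1
    let j := b.2
    if t = -t then
      if s = t then U₁ t i ⟨j.val, by omega⟩ else 0
    else if t < -t then
      if s = t then U₂ t (Sum.inl i) ⟨j.val, by omega⟩
      else if s = -t then U₂ t (Sum.inr i) ⟨j.val, by omega⟩
      else 0
    else
      if s = -t then U₂ (-t) (Sum.inl i) ⟨r + j.val, by omega⟩
      else if s = t then U₂ (-t) (Sum.inr i) ⟨r + j.val, by omega⟩
      else 0

/-- The truncated diagonal factor `Σ^{[r]}`, with the same arrangement of the components as in
`truncFactor`. -/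
def truncSigma {n₁ n₂ m r : ℕ} [NeZero m] (h : r ≤ min n₁ n₂)
    (σ₁ : Fin m → Fin (min n₁ n₂) → ℝ) (σ₂ : Fin m → Fin (min (2 * n₁) (2 * n₂)) → ℝ) :
    Matrix (Fin m × Fin r) (Fin m × Fin r) (Quaternion ℝ) :=
  Matrix.diagonal fun b =>
    let t := b.1
    let j := b.2
    if t = -t then ((σ₁ t ⟨j.val, by omega⟩ : ℝ) : Quaternion ℝ)
    else if t < -t then ((σ₂ t ⟨j.val, by omega⟩ : ℝ) : Quaternion ℝ)
    else ((σ₂ (-t) ⟨r + j.val, by omega⟩ : ℝ) : Quaternion ℝ)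

/-- `(Ur, Sr, Vr)` are factors `U^{[r]}, S^{[r]}, V^{[r]}` of a truncated quaternion T-SVD of `T`:
they come from quaternion SVDs of all blocks `G_t`, truncated to `r` components in the blocks with
`t = -t` and to `2 r` components in the blocks that join two different frequencies `t` and `-t`. -/
def IsTruncatedQTSVD {n₁ n₂ m r : ℕ} [NeZero m] (hr : r < min n₁ n₂) (μ : Quaternion ℝ)
    (T : QTensor n₁ n₂ m) (Ur : QTensor n₁ r m) (Sr : QTensor r r m) (Vr : QTensor n₂ r m) : Prop :=
  ∃ (U₁ : Fin m → Matrix (Fin n₁) (Fin n₁) (Quaternion ℝ))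
    (σ₁ : Fin m → Fin (min n₁ n₂) → ℝ)
    (V₁ : Fin m → Matrix (Fin n₂) (Fin n₂) (Quaternion ℝ))
    (U₂ : Fin m → Matrix (Fin n₁ ⊕ Fin n₁) (Fin (2 * n₁)) (Quaternion ℝ))
    (σ₂ : Fin m → Fin (min (2 * n₁) (2 * n₂)) → ℝ)
    (V₂ : Fin m → Matrix (Fin n₂ ⊕ Fin n₂) (Fin (2 * n₂)) (Quaternion ℝ)),
    (∀ t : Fin m, t = -t → IsQSVD r (singleBlock μ T t) (U₁ t) (σ₁ t) (V₁ t)) ∧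
    (∀ t : Fin m, t < -t → IsQSVD (2 * r) (pairBlock μ T t) (U₂ t) (σ₂ t) (V₂ t)) ∧
    bcirc Sr = fromFourier μ (truncSigma hr.le σ₁ σ₂) ∧
    bcirc Ur = fromFourier μ (truncFactor (hr.le.trans (min_le_left _ _)) U₁ U₂) ∧
    bcirc Vr = fromFourier μ (truncFactor (hr.le.trans (min_le_right _ _)) V₁ V₂)

end QTensor

end

noncomputable section

open scoped Quaternion

set_option linter.unusedSectionVars false

/-! The block Fourier transform is unitary, so `m` times the squared error of a tensor is the
squared Frobenius error of the transforms. Over ℍ the transform of a block circulant matrix need not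
be block diagonal. What survives is equivariance: its blocks satisfy χ_s D_{s,t} = D_{s,t} χ_t for
the powers χ of the root of unity. Comparing real parts forces D_{s,t} = 0 unless s = ±t
(`eq_or_eq_neg_of_chi_mul_eq`). Hence matrices, their products and their norms decompose along the
blocks G_t.

Optimality follows block by block: for any competitor X ⋆ Y, a block of its transform factors
through r columns (t = -t) or 2r columns (t ≠ -t). The quaternion Eckart–Young theorem
`nsq_sub_truncation_le` bounds each block error from below, and the truncation attains all these
bounds at once.

For existence, the assembled factors must be equivariant, and arbitrary SVDs of the pair blocks do
not achieve this. Let ν be a unit quaternion anticommuting with μ. Conjugation by diag(1, ν) carries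
a pair block into matrices over the centralizer of μ, a copy of ℂ, where an SVD is taken; hence
`exists_svd` is stated over a subalgebra of ℍ. The sorted singular values are then dealt alternately
to t and -t, so that the first r lateral slices retain the 2r largest ones for every r
simultaneously. -/

namespace QuaternionMatrix

open Matrix QTensor

/-! ### Frobenius norm and real trace of quaternion matrices -/

section

variable {ι κ γ : Type*} [Fintype ι] [Fintype κ] [Fintype γ]

/-- The squared Frobenius norm of a quaternion matrix. -/
def nsq (A : Matrix ι κ ℍ) : ℝ := ∑ i, ∑ j, ‖A i j‖ ^ 2

lemma re_mul_comm (a b : ℍ) : (a * b).re = (b * a).re := by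
  simp only [Quaternion.re_mul]; ring

lemma re_sum {α : Type*} (s : Finset α) (f : α → ℍ) : (∑ i ∈ s, f i).re = ∑ i ∈ s, (f i).re := by
  classical
  induction s using Finset.induction_on with
  | empty => simp
  | insert a s ha ih => simp [Finset.sum_insert ha, ih]

lemma star_mul_self_eq_norm_sq (a : ℍ) : star a * a = ((‖a‖ ^ 2 : ℝ) : ℍ) := by
  rw [Quaternion.star_mul_self, Quaternion.normSq_eq_norm_mul_self, sq]

lemma re_star_mul_self (a : ℍ) : (star a * a).re = ‖a‖ ^ 2 := by
  rw [star_mul_self_eq_norm_sq, Quaternion.re_coe]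

/-- Over ℍ the trace is not cyclic, but its real part is, because Re(ab) = Re(ba). -/
lemma re_trace_mul_comm (A : Matrix ι κ ℍ) (B : Matrix κ ι ℍ) :
    (A * B).trace.re = (B * A).trace.re := by
  simp only [trace, diag, mul_apply, re_sum]
  rw [Finset.sum_comm]
  simp only [re_mul_comm]

lemma nsq_eq_re_trace (A : Matrix ι κ ℍ) : nsq A = (Aᴴ * A).trace.re := by
  simp only [trace, diag, mul_apply, re_sum, conjTranspose_apply, re_star_mul_self, nsq]
  rw [Finset.sum_comm]

lemma nsq_conjTranspose (A : Matrix ι κ ℍ) : nsq Aᴴ = nsq A := by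
  rw [nsq_eq_re_trace, nsq_eq_re_trace, conjTranspose_conjTranspose, re_trace_mul_comm]

lemma nsq_unitary_mul [DecidableEq ι] {U : Matrix γ ι ℍ} (hU : Uᴴ * U = 1) (A : Matrix ι κ ℍ) :
    nsq (U * A) = nsq A := by
  rw [nsq_eq_re_trace, nsq_eq_re_trace, conjTranspose_mul, Matrix.mul_assoc,
    ← Matrix.mul_assoc Uᴴ, hU, Matrix.one_mul]

lemma nsq_mul_unitary [DecidableEq κ] {V : Matrix κ γ ℍ} (hV : V * Vᴴ = 1) (A : Matrix ι κ ℍ) :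
    nsq (A * V) = nsq A := by
  rw [← nsq_conjTranspose, conjTranspose_mul, nsq_unitary_mul (by simpa using hV),
    nsq_conjTranspose]

lemma nsq_submatrix {ι' κ' : Type*} [Fintype ι'] [Fintype κ'] (A : Matrix ι κ ℍ) (e : ι' ≃ ι)
    (f : κ' ≃ κ) : nsq (A.submatrix e f) = nsq A := by
  simp only [nsq, submatrix_apply]
  rw [Equiv.sum_comp e (fun i => ∑ j, ‖A i (f j)‖ ^ 2)]
  exact Finset.sum_congr rfl fun i _ => Equiv.sum_comp f (fun j => ‖A i j‖ ^ 2)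

/-- Conjugation is a ↦ 2 Re a - a, so every real subalgebra is closed under it. -/
lemma star_mem {S : Subalgebra ℝ ℍ} {a : ℍ} (ha : a ∈ S) : star a ∈ S := by
  have h : star a = algebraMap ℝ ℍ (2 * a.re) - a := by
    ext <;> simp [Quaternion.algebraMap_def]
    ring
  rw [h]
  exact sub_mem (S.algebraMap_mem _) ha

lemma coe_mem (S : Subalgebra ℝ ℍ) (x : ℝ) : (x : ℍ) ∈ S := S.algebraMap_mem x

/-- Matrices all of whose entries lie in the subalgebra `S`. -/
def EntriesIn {ι κ : Type*} (S : Subalgebra ℝ ℍ) (A : Matrix ι κ ℍ) : Prop := ∀ i j, A i j ∈ S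

namespace EntriesIn

variable {S : Subalgebra ℝ ℍ}

lemma mul {ι κ γ : Type*} [Fintype κ] {A : Matrix ι κ ℍ} {B : Matrix κ γ ℍ}
    (hA : EntriesIn S A) (hB : EntriesIn S B) : EntriesIn S (A * B) := fun i j => by
  rw [mul_apply]
  exact sum_mem fun k _ => mul_mem (hA i k) (hB k j)

lemma conjTranspose {ι κ : Type*} {A : Matrix ι κ ℍ} (hA : EntriesIn S A) : EntriesIn S Aᴴ :=
  fun i j => star_mem (hA j i)

lemma one {ι : Type*} [DecidableEq ι] : EntriesIn S (1 : Matrix ι ι ℍ) := fun i j => by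
  rw [one_apply]; split_ifs
  exacts [one_mem _, zero_mem _]

end EntriesIn

/-- Unitary matrices with entries in a subalgebra. -/
def unitariesIn (S : Subalgebra ℝ ℍ) (ι : Type*) [Fintype ι] [DecidableEq ι] :
    Set (Matrix ι ι ℍ) := {U | EntriesIn S U ∧ Uᴴ * U = 1 ∧ U * Uᴴ = 1}

/-! ### Unitary matrices over a subalgebra, and maximality of the real trace -/

section unitariesIn

variable {S : Subalgebra ℝ ℍ} [DecidableEq ι] [DecidableEq κ]

lemma one_mem_unitariesIn : (1 : Matrix ι ι ℍ) ∈ unitariesIn S ι := ⟨.one, by simp, by simp⟩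

lemma mul_mem_unitariesIn {U V : Matrix ι ι ℍ} (hU : U ∈ unitariesIn S ι)
    (hV : V ∈ unitariesIn S ι) : U * V ∈ unitariesIn S ι := by
  refine ⟨hU.1.mul hV.1, ?_, ?_⟩
  · rw [conjTranspose_mul, Matrix.mul_assoc, ← Matrix.mul_assoc Uᴴ, hU.2.1, Matrix.one_mul, hV.2.1]
  · rw [conjTranspose_mul, Matrix.mul_assoc, ← Matrix.mul_assoc V, hV.2.2, Matrix.one_mul, hU.2.2]

lemma conjTranspose_mem_unitariesIn {U : Matrix ι ι ℍ} (hU : U ∈ unitariesIn S ι) :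
    Uᴴ ∈ unitariesIn S ι :=
  ⟨hU.1.conjTranspose, by simpa using hU.2.2, by simpa using hU.2.1⟩

lemma norm_entry_le_one {U : Matrix ι ι ℍ} (hU : Uᴴ * U = 1) (i j : ι) : ‖U i j‖ ≤ 1 := by
  have h := congrArg (fun x : ℍ => x.re) (congrFun (congrFun hU j) j)
  simp only [mul_apply, conjTranspose_apply, re_sum, re_star_mul_self, one_apply_eq,
    Quaternion.re_one] at h
  have h2 : ‖U i j‖ ^ 2 ≤ 1 := h ▸
    Finset.single_le_sum (f := fun i => ‖U i j‖ ^ 2) (fun _ _ => sq_nonneg _) (Finset.mem_univ i)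
  exact (sq_le_one_iff₀ (norm_nonneg _)).1 h2

/-- The defining conditions are closed, since a subalgebra of ℍ is a finite-dimensional subspace,
and the entries of a unitary matrix are bounded by one. -/
lemma isCompact_unitariesIn : IsCompact (unitariesIn S ι) := by
  have : ProperSpace ℍ := FiniteDimensional.proper_real ℍ
  have hK : IsCompact (Set.univ.pi fun _ : ι => Set.univ.pi fun _ : ι =>
      Metric.closedBall (0 : ℍ) 1) :=
    isCompact_univ_pi fun _ => isCompact_univ_pi fun _ => isCompact_closedBall _ _
  refine IsCompact.of_isClosed_subset (s := (Set.univ.pi fun _ : ι => Set.univ.pi fun _ : ι =>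
      Metric.closedBall (0 : ℍ) 1)) hK ?_ ?_
  · have h1 : IsClosed {U : Matrix ι ι ℍ | EntriesIn S U} := by
      simp only [EntriesIn, Set.ofPred_forall]
      have hS : IsClosed (S : Set ℍ) := S.toSubmodule.closed_of_finiteDimensional
      exact isClosed_iInter fun i => isClosed_iInter fun j =>
        hS.preimage (continuous_id.matrix_elem i j)
    have h2 : IsClosed {U : Matrix ι ι ℍ | Uᴴ * U = 1} :=
      isClosed_eq (by fun_prop) continuous_const
    have h3 : IsClosed {U : Matrix ι ι ℍ | U * Uᴴ = 1} :=
      isClosed_eq (by fun_prop) continuous_const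
    exact h1.inter (h2.inter h3)
  · intro U hU i _ j _
    simpa using norm_entry_le_one hU.2.1 i j

/-- A partial rotation along the unit vector `w`. -/
lemma rotation_mem_unitariesIn {w : Matrix ι Unit ℍ} (hw : wᴴ * w = 1) (hwS : EntriesIn S w)
    {Q : Matrix Unit Unit ℍ} (hQ : Q ∈ unitariesIn S Unit) :
    1 - w * wᴴ + w * Q * wᴴ ∈ unitariesIn S ι := by
  -- Since wᴴw = 1, the summand w P wᴴ multiplies like P alone and is annihilated by 1 - w wᴴ. Both
  -- unitarity equations are instances of this identity.
  have key : ∀ P R : Matrix Unit Unit ℍ, P * R = 1 →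
      (1 - w * wᴴ + w * P * wᴴ) * (1 - w * wᴴ + w * R * wᴴ) = 1 := fun P R hPR => by
    have e1 : w * wᴴ * (w * wᴴ) = w * wᴴ := by
      rw [Matrix.mul_assoc, ← Matrix.mul_assoc wᴴ, hw, Matrix.one_mul]
    have e2 : w * P * wᴴ * (w * wᴴ) = w * P * wᴴ := by
      rw [Matrix.mul_assoc, ← Matrix.mul_assoc wᴴ, hw, Matrix.one_mul]
    have e3 : w * wᴴ * (w * R * wᴴ) = w * R * wᴴ := by
      rw [Matrix.mul_assoc, Matrix.mul_assoc, ← Matrix.mul_assoc wᴴ, hw, Matrix.one_mul]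
    have e4 : w * P * wᴴ * (w * R * wᴴ) = w * wᴴ := by
      rw [Matrix.mul_assoc, Matrix.mul_assoc, Matrix.mul_assoc, ← Matrix.mul_assoc wᴴ, hw,
        Matrix.one_mul, ← Matrix.mul_assoc P, hPR, Matrix.one_mul]
    rw [Matrix.add_mul, Matrix.mul_add, Matrix.mul_add, Matrix.sub_mul, Matrix.sub_mul,
      Matrix.mul_sub, Matrix.mul_sub, Matrix.mul_sub, e1, e2, e3, e4]
    simp only [Matrix.mul_one, Matrix.one_mul]
    abel
  have hT : (1 - w * wᴴ + w * Q * wᴴ)ᴴ = 1 - w * wᴴ + w * Qᴴ * wᴴ := by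
    simp [conjTranspose_mul, Matrix.mul_assoc]
  refine ⟨fun i j => ?_, ?_, ?_⟩
  · exact add_mem (sub_mem (EntriesIn.one i j) (hwS.mul hwS.conjTranspose i j))
      ((hwS.mul hQ.1).mul hwS.conjTranspose i j)
  · rw [hT]; exact key _ _ hQ.2.1
  · rw [hT]; exact key _ _ hQ.2.2

/-- A quaternion `z` whose real part cannot be increased by unit multipliers is real and
nonnegative. -/
lemma star_eq_self_of_re_le {z : ℍ} (hz : z ∈ S)
    (h : ∀ q ∈ S, star q * q = 1 → q * star q = 1 → (q * z).re ≤ z.re) :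
    star z = z ∧ 0 ≤ z.re := by
  rcases eq_or_ne z 0 with rfl | h0
  · simp
  have hn : ‖z‖ ≠ 0 := norm_ne_zero_iff.2 h0
  have hre : ‖z‖ ≤ z.re := by
    -- The multiplier z̄/‖z‖ turns z into ‖z‖, so ‖z‖ ≤ Re z and no imaginary part is left.
    have h1 := h (‖z‖⁻¹ • star z) (S.smul_mem (star_mem hz) _) ?_ ?_
    · rw [smul_mul_assoc, Quaternion.re_smul, re_star_mul_self, sq, smul_eq_mul,
        inv_mul_cancel_left₀ hn] at h1
      exact h1
    · rw [star_mul_self_eq_norm_sq, norm_smul, norm_star, norm_inv, norm_norm,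
        inv_mul_cancel₀ hn]; simp
    · have := star_mul_self_eq_norm_sq (star (‖z‖⁻¹ • star z))
      rw [star_star, norm_star] at this
      rw [this, norm_smul, norm_star, norm_inv, norm_norm, inv_mul_cancel₀ hn]; simp
  have hsq : z.re ^ 2 + z.imI ^ 2 + z.imJ ^ 2 + z.imK ^ 2 = ‖z‖ ^ 2 := by
    rw [← Quaternion.normSq_def', Quaternion.normSq_eq_norm_mul_self, sq]
  have h0' : 0 ≤ ‖z‖ := norm_nonneg z
  have hs : z.imI ^ 2 + z.imJ ^ 2 + z.imK ^ 2 ≤ 0 := by nlinarith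
  have hi : z.imI = 0 := by nlinarith [sq_nonneg z.imI, sq_nonneg z.imJ, sq_nonneg z.imK]
  have hj : z.imJ = 0 := by nlinarith [sq_nonneg z.imI, sq_nonneg z.imJ, sq_nonneg z.imK]
  have hk : z.imK = 0 := by nlinarith [sq_nonneg z.imI, sq_nonneg z.imJ, sq_nonneg z.imK]
  refine ⟨?_, h0'.trans hre⟩
  ext <;> simp [hi, hj, hk]

/-- If multiplication by unitary matrices cannot increase the real trace of `N`, all values of the
quadratic form of `N` are real and nonnegative. -/
lemma quadraticForm_nonneg {N : Matrix ι ι ℍ} (hN : EntriesIn S N)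
    (h : ∀ P ∈ unitariesIn S ι, (P * N).trace.re ≤ N.trace.re)
    {w : Matrix ι Unit ℍ} (hw : wᴴ * w = 1) (hwS : EntriesIn S w) :
    star ((wᴴ * N * w) () ()) = (wᴴ * N * w) () () ∧ 0 ≤ ((wᴴ * N * w) () ()).re := by
  refine star_eq_self_of_re_le (S := S) ((hwS.conjTranspose.mul hN).mul hwS _ _)
    fun q hq h1 h2 => ?_
  have hQ : (of fun _ _ => q : Matrix Unit Unit ℍ) ∈ unitariesIn S Unit := by
    refine ⟨fun _ _ => hq, ?_, ?_⟩ <;> refine Matrix.ext fun i j => ?_ <;>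
      simp [mul_apply, conjTranspose_apply, h1, h2]
  -- Rotating the line of w by q changes Re tr N by Re(qz) - Re z, where z = wᴴNw.
  have h3 := h _ (rotation_mem_unitariesIn hw hwS hQ)
  set Q : Matrix Unit Unit ℍ := of fun _ _ => q with hQdef
  have e1 : (w * wᴴ * N).trace.re = ((wᴴ * N * w) () ()).re := by
    rw [Matrix.mul_assoc, re_trace_mul_comm]; simp [trace]
  have e2 : (w * Q * wᴴ * N).trace.re = (q * (wᴴ * N * w) () ()).re := by
    rw [Matrix.mul_assoc, Matrix.mul_assoc, re_trace_mul_comm, Matrix.mul_assoc]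
    rw [trace, Finset.univ_unique, Finset.sum_singleton, diag, mul_apply, Finset.univ_unique,
      Finset.sum_singleton]
    rfl
  rw [Matrix.add_mul, Matrix.sub_mul, Matrix.one_mul, trace_add, trace_sub, Quaternion.re_add,
    Quaternion.re_sub, e1, e2] at h3
  linarith

/-- Under the hypothesis of `quadraticForm_nonneg`, `N` is Hermitian with nonnegative diagonal. -/
lemma isHermitian_of_re_trace_le {μ : ℍ} (hμ : μ ∈ S) (hμs : star μ = -μ) (hμ1 : star μ * μ = 1)
    {N : Matrix ι ι ℍ} (hN : EntriesIn S N)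
    (h : ∀ P ∈ unitariesIn S ι, (P * N).trace.re ≤ N.trace.re) :
    (∀ i j, N i j = star (N j i)) ∧ ∀ i, 0 ≤ (N i i).re := by
  have hdiag : ∀ i, star (N i i) = N i i ∧ 0 ≤ (N i i).re := fun i => by
    have := quadraticForm_nonneg hN h (w := of fun k _ => if k = i then 1 else 0) ?_ ?_
    · simpa only [mul_apply, conjTranspose_apply, of_apply, apply_ite star, star_one, star_zero,
        ite_mul, mul_ite, one_mul, mul_one, zero_mul, mul_zero, Finset.sum_ite_eq',
        Finset.mem_univ, if_true] using this
    · refine Matrix.ext fun a b => ?_; simp [mul_apply, conjTranspose_apply, apply_ite star]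
    · intro a b; simp only [of_apply]; split_ifs
      exacts [one_mem _, zero_mem _]
  -- Polarization with w = (e_i + e_j q)/√2: the form is real on w and on the diagonal, hence so is
  -- the cross term.
  have hoff : ∀ i j, i ≠ j → ∀ q ∈ S, star q * q = 1 →
      star (N i j * q + star q * N j i) = N i j * q + star q * N j i := fun i j hij q hq hq1 => by
    set s : ℝ := √2⁻¹ with hs
    have hss : s * s = 2⁻¹ := Real.mul_self_sqrt (by norm_num)
    have := (quadraticForm_nonneg hN h
      (w := of fun k _ => (if k = i then (s : ℍ) else 0) + (if k = j then (s : ℍ) * q else 0))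
      ?_ ?_).1
    · simp [mul_apply, conjTranspose_apply, Finset.sum_add_distrib, add_mul, mul_add,
        apply_ite star, ite_mul, mul_ite] at this
      simp only [← smul_add, Quaternion.coe_mul_eq_smul, Quaternion.mul_coe_eq_smul,
        mul_smul_comm, smul_mul_assoc, smul_smul, hss, ← mul_assoc, (hdiag i).1, (hdiag j).1]
        at this
      have h2 := smul_right_injective ℍ (inv_ne_zero (two_ne_zero' ℝ)) this
      simp only [star_add, star_mul, star_star]
      refine add_left_cancel (a := N i i + star q * N j j * q) ?_
      calc _ = N i i + star (N j i) * q + (star q * star (N i j) + star q * N j j * q) := by abel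
        _ = _ := h2
        _ = _ := by abel
    · refine Matrix.ext fun a b => ?_
      simp [mul_apply, conjTranspose_apply, Finset.sum_add_distrib, add_mul, mul_add,
        apply_ite star, ite_mul, mul_ite, hij, hij.symm]
      simp only [Quaternion.coe_mul_eq_smul, Quaternion.mul_coe_eq_smul, mul_smul_comm,
        smul_mul_assoc, hq1, smul_smul]
      rw [Quaternion.smul_coe, hss, ← Quaternion.coe_mul_eq_smul, mul_one, ← Quaternion.coe_add]
      norm_num
    · intro a b; simp only [of_apply]
      refine add_mem ?_ ?_ <;> split_ifs
      exacts [coe_mem S s, zero_mem _, mul_mem (coe_mem S s) hq, zero_mem _]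
  refine ⟨fun i j => ?_, fun i => (hdiag i).2⟩
  rcases eq_or_ne i j with rfl | hij
  · exact (hdiag i).1.symm
  -- Put d = N i j - star (N j i). Taking q = 1 shows that d is real, and q = μ that d anticommutes
  -- with μ, so d = 0. This is where `S` must contain an imaginary unit.
  have h1 := hoff i j hij 1 (one_mem _) (by simp)
  have h2 := hoff i j hij μ hμ hμ1
  simp only [star_one, mul_one, one_mul, star_add] at h1
  simp only [star_add, star_mul, hμs, neg_mul] at h2
  have hd : star (N i j - star (N j i)) = N i j - star (N j i) := by
    rw [star_sub, star_star, sub_eq_sub_iff_add_eq_add, h1]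
  have hanti : (N i j - star (N j i)) * μ + μ * (N i j - star (N j i)) = 0 := by
    have e : N i j - star (N j i) = star (N i j) - N j i := by
      rw [← hd, star_sub, star_star]
    nth_rewrite 2 [e]
    rw [sub_mul, mul_sub]
    have := sub_eq_zero.2 h2
    rw [star_neg, star_mul, hμs, mul_neg, neg_neg] at this
    rw [← neg_eq_zero, ← this]; abel
  rw [Quaternion.star_eq_self] at hd
  rw [hd, Quaternion.coe_mul_eq_smul, Quaternion.mul_coe_eq_smul, ← two_smul ℝ, smul_smul,
    smul_eq_zero] at hanti
  have hr : (N i j - star (N j i)).re = 0 := by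
    rcases hanti with h | h
    · simpa using h
    · simp [h] at hμ1
  rw [hr, Quaternion.coe_zero] at hd
  exact sub_eq_zero.1 hd

end unitariesIn

end

/-! ### Singular value decompositions by maximizing a weighted trace -/

section

/-- A permutation of `ℕ` that preserves `{k | k < n}`, as a permutation of `Fin n`. -/
def permFin (e : Equiv.Perm ℕ) {n : ℕ} (h : ∀ k, e k < n ↔ k < n) : Equiv.Perm (Fin n) where
  toFun k := ⟨e k, (h k).2 k.2⟩
  invFun k := ⟨e.symm k, (h _).1 (by simp)⟩
  left_inv k := by simp
  right_inv k := by simp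

/-- The permutation sorting the `min p q` singular values must also act on the p columns of U and
the q columns of V. Extended to ℕ by the identity, one permutation serves all three index sets. -/
lemma exists_permFin {n : ℕ} (π : Equiv.Perm (Fin n)) :
    ∃ e : Equiv.Perm ℕ, ∃ h : ∀ k, e k < n ↔ k < n, permFin e h = π ∧ ∀ k, n ≤ k → e k = k := by
  have h1 : ∀ k, n ≤ k → π.extendDomain Fin.equivSubtype k = k := fun k hk =>
    Equiv.Perm.extendDomain_apply_not_subtype _ _ (by omega)
  have h2 : ∀ k (hk : k < n), π.extendDomain Fin.equivSubtype k = π ⟨k, hk⟩ := fun k hk => by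
    exact Equiv.Perm.extendDomain_apply_subtype π Fin.equivSubtype hk
  refine ⟨π.extendDomain Fin.equivSubtype, fun k => ⟨fun h => ?_, fun h => ?_⟩, ?_, h1⟩
  · by_contra hk
    rw [h1 k (by omega)] at h
    exact hk h
  · rw [h2 k h]; exact Fin.isLt _
  · ext k
    exact h2 k k.2

lemma rectDiag_submatrix {p q : ℕ} (σ : Fin (min p q) → ℝ) (e : Equiv.Perm ℕ)
    (hp : ∀ k, e k < p ↔ k < p) (hq : ∀ k, e k < q ↔ k < q)
    (hm : ∀ k, e k < min p q ↔ k < min p q) :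
    (rectDiag σ).submatrix (permFin e hp) (permFin e hq) = rectDiag (σ ∘ permFin e hm) := by
  refine Matrix.ext fun i j => ?_
  simp only [rectDiag, submatrix_apply, of_apply, permFin, Equiv.coe_fn_mk, Function.comp_apply,
    EmbeddingLike.apply_eq_iff_eq]

lemma conjTranspose_submatrix_mul {ι κ κ' : Type*} [Fintype ι] [DecidableEq κ] [DecidableEq ι]
    [Fintype κ] [DecidableEq κ'] [Fintype κ'] {U : Matrix ι κ ℍ} (h : Uᴴ * U = 1 ∧ U * Uᴴ = 1)
    (e : κ' ≃ κ) :
    (U.submatrix id e)ᴴ * U.submatrix id e = 1 ∧ U.submatrix id e * (U.submatrix id e)ᴴ = 1 := by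
  constructor
  · rw [conjTranspose_submatrix, submatrix_mul _ _ _ id _ Function.bijective_id |>.symm, h.1,
      submatrix_one_equiv]
  · rw [conjTranspose_submatrix, submatrix_mul_equiv, h.2, submatrix_id_id]

/-- The weight matrix of the variational characterization of singular value decompositions. -/
def weight (p q : ℕ) : Matrix (Fin p) (Fin q) ℍ :=
  of fun i j => if i.val = j.val then ((i.val + 1 : ℝ) : ℍ) else 0

lemma mul_weight_transpose_apply {p q : ℕ} (B : Matrix (Fin p) (Fin q) ℍ) (i : Fin p)
    {k : ℕ} (hp : k < p) (hq : k < q) :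
    (B * (weight p q)ᵀ) i ⟨k, hp⟩ = (k + 1 : ℝ) • B i ⟨k, hq⟩ := by
  rw [mul_apply, Finset.sum_eq_single ⟨k, hq⟩]
  · simp [weight, ← Quaternion.mul_coe_eq_smul]
  · intro l _ hl
    have : k ≠ l.val := fun h => hl (Fin.ext h.symm)
    simp [weight, this]
  · simp

lemma mul_weight_transpose_apply_eq_zero {p q : ℕ} (B : Matrix (Fin p) (Fin q) ℍ) (i : Fin p)
    {k : Fin p} (hq : q ≤ k) : (B * (weight p q)ᵀ) i k = 0 := by
  rw [mul_apply]
  refine Finset.sum_eq_zero fun l _ => ?_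
  have : k.val ≠ l.val := by omega
  simp [weight, this]

lemma weight_transpose_mul_apply {p q : ℕ} (B : Matrix (Fin p) (Fin q) ℍ) (j : Fin q)
    {k : ℕ} (hp : k < p) (hq : k < q) :
    ((weight p q)ᵀ * B) ⟨k, hq⟩ j = (k + 1 : ℝ) • B ⟨k, hp⟩ j := by
  rw [mul_apply, Finset.sum_eq_single ⟨k, hp⟩]
  · simp [weight, ← Quaternion.coe_mul_eq_smul]
  · intro l _ hl
    have : l.val ≠ k := fun h => hl (Fin.ext h)
    simp [weight, this]
  · simp

lemma weight_transpose_mul_apply_eq_zero {p q : ℕ} (B : Matrix (Fin p) (Fin q) ℍ) (j : Fin q)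
    {k : Fin q} (hp : p ≤ k) : ((weight p q)ᵀ * B) k j = 0 := by
  rw [mul_apply]
  refine Finset.sum_eq_zero fun l _ => ?_
  have : l.val ≠ k.val := by omega
  simp [weight, this]

variable {S : Subalgebra ℝ ℍ}

lemma entriesIn_weight (p q : ℕ) : EntriesIn S (weight p q) := fun i j => by
  simp only [weight, of_apply]; split_ifs
  exacts [coe_mem S _, zero_mem _]

lemma exists_re_trace_max {p q : ℕ} (M : Matrix (Fin p) (Fin q) ℍ) (W : Matrix (Fin q) (Fin p) ℍ) :
    ∃ U ∈ unitariesIn S (Fin p), ∃ V ∈ unitariesIn S (Fin q),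
      ∀ U' ∈ unitariesIn S (Fin p), ∀ V' ∈ unitariesIn S (Fin q),
        (W * (U'ᴴ * M * V')).trace.re ≤ (W * (Uᴴ * M * V)).trace.re := by
  have hcont : Continuous fun P : Matrix (Fin p) (Fin p) ℍ × Matrix (Fin q) (Fin q) ℍ =>
      (W * (P.1ᴴ * M * P.2)).trace.re :=
    Quaternion.continuous_re.comp (by fun_prop)
  obtain ⟨⟨U, V⟩, hUV, hmax⟩ :=
    ((isCompact_unitariesIn (S := S) (ι := Fin p)).prod
      (isCompact_unitariesIn (S := S) (ι := Fin q))).exists_isMaxOn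
      ⟨(1, 1), one_mem_unitariesIn, one_mem_unitariesIn⟩ hcont.continuousOn
  exact ⟨U, hUV.1, V, hUV.2, fun U' hU' V' hV' => hmax (a := (U', V')) ⟨hU', hV'⟩⟩

/-- The two symmetries give (j+1) B i j = (i+1) y and (i+1) B i j = (j+1) y with y = star (B j i).
Eliminating y leaves ((j+1)² - (i+1)²) B i j = 0, and the weights are distinct. Outside the square
part, one symmetry already equates a nonzero multiple of B i j with zero. -/
lemma apply_eq_zero_of_isHermitian_mul_weight {p q : ℕ} {B : Matrix (Fin p) (Fin q) ℍ}
    (h1 : ∀ i j, (B * (weight p q)ᵀ) i j = star ((B * (weight p q)ᵀ) j i))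
    (h2 : ∀ i j, ((weight p q)ᵀ * B) i j = star (((weight p q)ᵀ * B) j i))
    (i : Fin p) (j : Fin q) (hij : i.val ≠ j.val) : B i j = 0 := by
  obtain ⟨i, hip⟩ := i
  obtain ⟨j, hjq⟩ := j
  have hij' : i ≠ j := hij
  -- The shift by one in `weight` keeps index 0 from having weight zero; the entries outside the
  -- square part need this.
  have hi0 : (i + 1 : ℝ) ≠ 0 := by positivity
  have hj0 : (j + 1 : ℝ) ≠ 0 := by positivity
  by_cases hjp : j < p
  · have e1 := h1 ⟨i, hip⟩ ⟨j, hjp⟩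
    rw [mul_weight_transpose_apply _ _ hjp hjq] at e1
    by_cases hiq : i < q
    · have e2 := h2 ⟨i, hiq⟩ ⟨j, hjq⟩
      rw [weight_transpose_mul_apply _ _ hip hiq, weight_transpose_mul_apply _ _ hjp hjq,
        Quaternion.star_smul] at e2
      rw [mul_weight_transpose_apply _ _ hip hiq, Quaternion.star_smul] at e1
      set x := B ⟨i, hip⟩ ⟨j, hjq⟩
      set y := star (B ⟨j, hjp⟩ ⟨i, hiq⟩)
      have e3 : ((j + 1 : ℝ) * (j + 1) - (i + 1) * (i + 1)) • x = 0 := by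
        rw [sub_smul, mul_smul, mul_smul, e1, e2, smul_smul, smul_smul, mul_comm, sub_self]
      refine (smul_eq_zero.1 e3).resolve_left fun h => hij' ?_
      have h4 : ((j : ℝ) - i) * (j + i + 2) = 0 := by linarith
      have h5 : (j + i + 2 : ℝ) ≠ 0 := by positivity
      exact_mod_cast (sub_eq_zero.1 ((mul_eq_zero.1 h4).resolve_right h5)).symm
    · rw [mul_weight_transpose_apply_eq_zero _ _ (by simpa using hiq), star_zero,
        smul_eq_zero] at e1
      exact e1.resolve_left hj0
  · have hiq : i < q := by omega
    have e2 := h2 ⟨i, hiq⟩ ⟨j, hjq⟩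
    rw [weight_transpose_mul_apply _ _ hip hiq,
      weight_transpose_mul_apply_eq_zero _ _ (by simpa using hjp), star_zero, smul_eq_zero] at e2
    exact e2.resolve_left hi0

lemma exists_rectDiag_of_isHermitian_mul_weight {p q : ℕ} {B : Matrix (Fin p) (Fin q) ℍ}
    (h1 : ∀ i j, (B * (weight p q)ᵀ) i j = star ((B * (weight p q)ᵀ) j i))
    (h2 : ∀ i j, ((weight p q)ᵀ * B) i j = star (((weight p q)ᵀ * B) j i))
    (h3 : ∀ i, 0 ≤ (((weight p q)ᵀ * B) i i).re) :
    ∃ σ : Fin (min p q) → ℝ, (∀ k, 0 ≤ σ k) ∧ B = rectDiag σ := by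
  have hd : ∀ k : ℕ, ∀ (hp : k < p) (hq : k < q),
      B ⟨k, hp⟩ ⟨k, hq⟩ = ((B ⟨k, hp⟩ ⟨k, hq⟩).re : ℍ) ∧ 0 ≤ (B ⟨k, hp⟩ ⟨k, hq⟩).re := by
    intro k hp hq
    have hk : (0 : ℝ) < k + 1 := by positivity
    have e := h2 ⟨k, hq⟩ ⟨k, hq⟩
    have e' := h3 ⟨k, hq⟩
    rw [weight_transpose_mul_apply _ _ hp hq, Quaternion.star_smul] at e
    rw [weight_transpose_mul_apply _ _ hp hq, Quaternion.re_smul, smul_eq_mul] at e'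
    exact ⟨Quaternion.star_eq_self.1 (smul_right_injective ℍ hk.ne' e).symm,
      nonneg_of_mul_nonneg_right e' hk⟩
  refine ⟨fun k => (B ⟨k, k.2.trans_le (min_le_left _ _)⟩
    ⟨k, k.2.trans_le (min_le_right _ _)⟩).re, fun k => (hd k _ _).2, ?_⟩
  refine Matrix.ext fun i j => ?_
  simp only [rectDiag, of_apply]
  split_ifs with h
  · obtain ⟨i, hi⟩ := i
    obtain ⟨j, hj⟩ := j
    obtain rfl : i = j := h
    exact (hd i _ _).1
  · exact apply_eq_zero_of_isHermitian_mul_weight h1 h2 i j h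

/-- Choose U, V maximizing Re tr(wᵀB) for B = UᴴMV and w = `weight p q`. Replacing U by UPᴴ, or V by
VP, multiplies B by the unitary P on the left or on the right. Maximality therefore makes Bwᵀ and
wᵀB Hermitian with nonnegative diagonal, and this forces B to be real nonnegative diagonal. -/
lemma exists_unsorted_svd {μ : ℍ} (hμ : μ ∈ S) (hμs : star μ = -μ) (hμ1 : star μ * μ = 1)
    {p q : ℕ} {M : Matrix (Fin p) (Fin q) ℍ} (hM : EntriesIn S M) :
    ∃ U ∈ unitariesIn S (Fin p), ∃ V ∈ unitariesIn S (Fin q), ∃ σ : Fin (min p q) → ℝ,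
      (∀ k, 0 ≤ σ k) ∧ Uᴴ * M * V = rectDiag σ := by
  obtain ⟨U, hU, V, hV, hmax⟩ := exists_re_trace_max (S := S) M (weight p q)ᵀ
  have hBS : EntriesIn S (Uᴴ * M * V) := (hU.1.conjTranspose.mul hM).mul hV.1
  have hWT : EntriesIn S (weight p q)ᵀ := fun i j => entriesIn_weight p q j i
  obtain ⟨h1, -⟩ := isHermitian_of_re_trace_le hμ hμs hμ1 (hBS.mul hWT) fun P hP => by
    have := hmax _ (mul_mem_unitariesIn hU (conjTranspose_mem_unitariesIn hP)) V hV
    rw [← Matrix.mul_assoc, re_trace_mul_comm, re_trace_mul_comm (Uᴴ * M * V)]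
    simpa only [conjTranspose_mul, conjTranspose_conjTranspose, Matrix.mul_assoc] using this
  obtain ⟨h2, h3⟩ := isHermitian_of_re_trace_le hμ hμs hμ1 (hWT.mul hBS) fun P hP => by
    have := hmax U hU _ (mul_mem_unitariesIn hV hP)
    rw [re_trace_mul_comm]
    simpa only [Matrix.mul_assoc] using this
  obtain ⟨σ, h0, h⟩ := exists_rectDiag_of_isHermitian_mul_weight h1 h2 h3
  exact ⟨U, hU, V, hV, σ, h0, h⟩

/-- Singular value decompositions over a subalgebra of the quaternions that contains an imaginary
unit. -/
theorem exists_svd {μ : ℍ} (hμ : μ ∈ S) (hμs : star μ = -μ) (hμ1 : star μ * μ = 1)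
    {p q : ℕ} {M : Matrix (Fin p) (Fin q) ℍ} (hM : EntriesIn S M) :
    ∃ U ∈ unitariesIn S (Fin p), ∃ V ∈ unitariesIn S (Fin q), ∃ σ : Fin (min p q) → ℝ,
      (∀ k, 0 ≤ σ k) ∧ Antitone σ ∧ Uᴴ * M * V = rectDiag σ := by
  obtain ⟨U, hU, V, hV, σ, h0, h⟩ := exists_unsorted_svd hμ hμs hμ1 hM
  obtain ⟨e, he, hπ, hid⟩ := exists_permFin (Tuple.sort fun k => -σ k)
  have hpres : ∀ n, min p q ≤ n → ∀ k, e k < n ↔ k < n := fun n hn k => by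
    by_cases hk : k < min p q
    · have := (he k).2 hk; omega
    · rw [hid k (by omega)]
  have hp := hpres p (min_le_left _ _)
  have hq := hpres q (min_le_right _ _)
  refine ⟨U.submatrix id (permFin e hp),
    ⟨fun i j => hU.1 _ _, conjTranspose_submatrix_mul hU.2 _⟩, V.submatrix id (permFin e hq),
    ⟨fun i j => hV.1 _ _, conjTranspose_submatrix_mul hV.2 _⟩, σ ∘ permFin e he,
    fun k => h0 _, ?_, ?_⟩
  · intro k l hkl
    have := Tuple.monotone_sort (fun k => -σ k) hkl
    rw [hπ]
    simpa using this
  · rw [← rectDiag_submatrix σ e hp hq he, ← h]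
    rfl

end

/-! ### The Eckart–Young theorem for quaternion matrices -/

section

lemma exists_imaginary_unit : ∃ μ : ℍ, star μ = -μ ∧ star μ * μ = 1 := by
  obtain ⟨i, h0, h1, h2, h3⟩ : ∃ i : ℍ, i.re = 0 ∧ i.imI = 1 ∧ i.imJ = 0 ∧ i.imK = 0 :=
    ⟨⟨0, 1, 0, 0⟩, rfl, rfl, rfl, rfl⟩
  refine ⟨i, Quaternion.star_eq_neg.2 h0, ?_⟩
  rw [Quaternion.star_mul_self, Quaternion.normSq_def', h0, h1, h2, h3]
  simp

/-- The column space of a matrix with `c` columns lies in the span of the first `c` columns of a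
unitary matrix. -/
lemma exists_unitary_mul_eq_zero {p c : ℕ} {γ : Type*} [Fintype γ] (hγ : Fintype.card γ = c)
    (X : Matrix (Fin p) γ ℍ) :
    ∃ U : Matrix (Fin p) (Fin p) ℍ, (Uᴴ * U = 1 ∧ U * Uᴴ = 1) ∧
      ∀ i g, c ≤ i.val → (Uᴴ * X) i g = 0 := by
  let e : γ ≃ Fin c := Fintype.equivFinOfCardEq hγ
  obtain ⟨μ, hs, h1⟩ := exists_imaginary_unit
  obtain ⟨U, hU, V, hV, σ, -, -, h⟩ := exists_svd (S := ⊤) (μ := μ) trivial hs h1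
    (M := X.submatrix id e.symm) fun _ _ => trivial
  refine ⟨U, hU.2, fun i g hi => ?_⟩
  -- From an SVD of X, UᴴX is a rectangular diagonal matrix with only c columns times Vᴴ, so its
  -- rows from c on vanish.
  have h2 : Uᴴ * X.submatrix id e.symm = rectDiag σ * Vᴴ := by
    rw [← h, Matrix.mul_assoc, hV.2.2, Matrix.mul_one]
  have h3 : (Uᴴ * X) i g = (Uᴴ * X.submatrix id e.symm) i (e g) := by
    simp [mul_apply]
  rw [h3, h2, mul_apply]
  refine Finset.sum_eq_zero fun k _ => ?_
  have : i.val ≠ k.val := by omega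
  simp [rectDiag, this]

/-- Compare with the largest tail value τ l: every (τ k - τ l)(a k - [c ≤ k]) is nonnegative, as
head values lie above τ l and tail values below. Summation leaves τ l (∑ a k - (N - c)), which is
nonnegative. The hypothesis c < N provides a nonempty tail. -/
lemma sum_tail_le {N c : ℕ} (hc : c < N) {τ a : Fin N → ℝ}
    (hl : ∀ k l : Fin N, k.val < c → c ≤ l.val → τ l ≤ τ k) (hτ : ∀ k, 0 ≤ τ k)
    (ha0 : ∀ k, 0 ≤ a k) (ha1 : ∀ k, a k ≤ 1) (hs : ∑ k, (1 - a k) ≤ c) :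
    ∑ k, (if c ≤ k.val then τ k else 0) ≤ ∑ k, τ k * a k := by
  obtain ⟨l, hlm, hmax⟩ := Finset.exists_max_image
    (Finset.univ.filter fun k : Fin N => c ≤ k.val) τ ⟨⟨c, hc⟩, by simp⟩
  simp only [Finset.mem_filter, Finset.mem_univ, true_and] at hlm hmax
  have hterm : ∀ k, τ l * (a k - if c ≤ k.val then 1 else 0) ≤
      τ k * a k - if c ≤ k.val then τ k else 0 := fun k => by
    split_ifs with hk
    · nlinarith [hmax k hk, ha1 k]
    · nlinarith [hl k l (by omega) hlm, ha0 k]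
  have hcount : ∑ k : Fin N, (if c ≤ k.val then (1 : ℝ) else 0) = N - c := by
    have h1 : ∑ k : Fin N, (if k.val < c then (1 : ℝ) else 0) = c := by
      rw [Finset.sum_boole, Fin.card_filter_val_lt, min_eq_right hc.le]
    have h2 : ∑ k : Fin N, ((if c ≤ k.val then (1 : ℝ) else 0) +
        if k.val < c then 1 else 0) = N := by
      rw [Finset.sum_congr rfl (g := fun _ => (1 : ℝ))]
      · simp
      · intro k _; by_cases h : c ≤ k.val
        · simp [h, not_lt.2 h]
        · simp [h, not_le.1 h]
    rw [Finset.sum_add_distrib] at h2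
    linarith
  have h := Finset.sum_le_sum fun k (_ : k ∈ Finset.univ) => hterm k
  rw [← Finset.mul_sum, Finset.sum_sub_distrib, Finset.sum_sub_distrib, hcount] at h
  simp only [Finset.sum_sub_distrib, Finset.sum_const, Finset.card_univ, Fintype.card_fin,
    nsmul_eq_mul, mul_one] at hs
  have := mul_nonneg (hτ l) (show (0 : ℝ) ≤ ∑ k, a k - (N - c) by linarith)
  linarith

lemma sum_norm_sq_row {ι : Type*} [Fintype ι] [DecidableEq ι] {U : Matrix ι ι ℍ}
    (h : U * Uᴴ = 1) (i : ι) : ∑ j, ‖U i j‖ ^ 2 = 1 := by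
  have := congrArg (fun x : ℍ => x.re) (congrFun (congrFun h i) i)
  simpa only [mul_apply, conjTranspose_apply, re_sum, re_mul_comm (U i _), re_star_mul_self,
    one_apply_eq, Quaternion.re_one] using this

lemma sum_norm_sq_col {ι : Type*} [Fintype ι] [DecidableEq ι] {U : Matrix ι ι ℍ}
    (h : Uᴴ * U = 1) (j : ι) : ∑ i, ‖U i j‖ ^ 2 = 1 := by
  have := congrArg (fun x : ℍ => x.re) (congrFun (congrFun h j) j)
  simpa only [mul_apply, conjTranspose_apply, re_sum, re_star_mul_self,
    one_apply_eq, Quaternion.re_one] using this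

lemma mul_rectDiag_apply {ι : Type*} {p q : ℕ} (A : Matrix ι (Fin p) ℍ)
    (σ : Fin (min p q) → ℝ) (i : ι) (k : Fin (min p q)) :
    (A * rectDiag σ) i (Fin.castLE (min_le_right p q) k) =
      σ k • A i (Fin.castLE (min_le_left p q) k) := by
  rw [mul_apply, Finset.sum_eq_single (Fin.castLE (min_le_left p q) k)]
  · simp [rectDiag, ← Quaternion.mul_coe_eq_smul]
  · intro l _ hl
    have : l.val ≠ k.val := fun h => hl (Fin.ext h)
    simp [rectDiag, this]
  · simp

lemma nsq_rectDiag {p q : ℕ} (σ : Fin (min p q) → ℝ) : nsq (rectDiag σ) = ∑ k, σ k ^ 2 := by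
  rw [nsq, ← Fintype.sum_prod_type']
  refine (Fintype.sum_of_injective
    (fun k => (Fin.castLE (min_le_left p q) k, Fin.castLE (min_le_right p q) k)) ?_ _ _ ?_ ?_).symm
  · intro k l h
    simpa [Fin.ext_iff] using h
  · rintro ⟨i, j⟩ h
    simp only [rectDiag, of_apply]
    split_ifs with hij
    · exact absurd ⟨⟨i, lt_min i.isLt (hij ▸ j.isLt)⟩, by simp [Fin.ext_iff, hij]⟩ h
    · simp
  · intro k
    simp [rectDiag]

/-- Multiply by Uᴴ, where U is unitary and the rows of UᴴX from c on vanish. Those rows of the error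
are rows of UᴴΣ, so the error is at least ∑ σ_k² a_k with a_k = ∑_{i ≥ c} |U_{ki}|². The weights lie
in [0, 1] and have total defect at most c, so `sum_tail_le` applies. -/
theorem sum_tail_sq_le_nsq_rectDiag_sub_mul {p q c : ℕ} (hc : c < min p q)
    {σ : Fin (min p q) → ℝ} (h0 : ∀ k, 0 ≤ σ k)
    (hl : ∀ k l : Fin (min p q), k.val < c → c ≤ l.val → σ l ≤ σ k)
    {γ : Type*} [Fintype γ] (hγ : Fintype.card γ = c)
    (X : Matrix (Fin p) γ ℍ) (Y : Matrix γ (Fin q) ℍ) :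
    ∑ k, (if c ≤ k.val then σ k ^ 2 else 0) ≤ nsq (rectDiag σ - X * Y) := by
  obtain ⟨U, hU, hX⟩ := exists_unitary_mul_eq_zero hγ X
  have hb : ∀ k, ∑ i : Fin p, (if c ≤ i.val then ‖U k i‖ ^ 2 else 0) ≤ 1 := fun k => by
    rw [← sum_norm_sq_row hU.2 k]
    exact Finset.sum_le_sum fun i _ => by split_ifs <;> simp
  have hdiff : ∀ k, 1 - ∑ i : Fin p, (if c ≤ i.val then ‖U k i‖ ^ 2 else 0) =
      ∑ i : Fin p, (if i.val < c then ‖U k i‖ ^ 2 else 0) := fun k => by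
    rw [← sum_norm_sq_row hU.2 k, ← Finset.sum_sub_distrib]
    refine Finset.sum_congr rfl fun i _ => ?_
    by_cases h : c ≤ i.val
    · simp [h, not_lt.2 h]
    · simp [h, not_le.1 h]
  have hinj : Function.Injective (Fin.castLE (min_le_left p q)) := Fin.castLE_injective _
  -- The first c columns of U are unit vectors, so the defects 1 - a_k add up to c over all p rows;
  -- restriction to the first `min p q` rows can only lower the sum.
  have hsum : ∑ k : Fin p, (1 - ∑ i : Fin p, (if c ≤ i.val then ‖U k i‖ ^ 2 else 0)) = c := by
    simp only [hdiff]
    rw [Finset.sum_comm]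
    have : ∀ i : Fin p, ∑ k, (if i.val < c then ‖U k i‖ ^ 2 else 0) = if i.val < c then 1 else 0 :=
      fun i => by
        split_ifs
        · exact sum_norm_sq_col hU.1 i
        · simp
    simp only [this]
    rw [Finset.sum_boole, Fin.card_filter_val_lt,
      min_eq_right (hc.le.trans (min_le_left _ _))]
  refine (sum_tail_le hc (τ := fun k => σ k ^ 2)
    (a := fun k => ∑ i : Fin p, if c ≤ i.val then ‖U (Fin.castLE (min_le_left p q) k) i‖ ^ 2 else 0)
    (fun k l hk hl' => pow_le_pow_left₀ (h0 l) (hl k l hk hl') 2) (fun k => sq_nonneg _)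
    (fun k => Finset.sum_nonneg fun i _ => by split_ifs <;> positivity) (fun k => hb _) ?_).trans ?_
  · rw [← hsum]
    refine (Finset.sum_map Finset.univ ⟨_, hinj⟩ fun k : Fin p =>
      1 - ∑ i : Fin p, (if c ≤ i.val then ‖U k i‖ ^ 2 else 0)).symm.le.trans ?_
    exact Finset.sum_le_univ_sum_of_nonneg fun k => sub_nonneg.2 (hb k)
  · rw [← nsq_unitary_mul (U := Uᴴ) (by simpa using hU.2), Matrix.mul_sub, nsq]
    simp only [Finset.mul_sum]
    rw [Finset.sum_comm]
    refine Finset.sum_le_sum fun i _ => ?_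
    by_cases hi : c ≤ i.val
    · simp only [hi, if_true]
      have hrow : ∀ j, (Uᴴ * rectDiag σ - Uᴴ * (X * Y)) i j = (Uᴴ * rectDiag σ) i j := fun j => by
        rw [Matrix.sub_apply, ← Matrix.mul_assoc, mul_apply (M := Uᴴ * X)]
        simp [hX i _ hi]
      simp only [hrow]
      have hinj' : Function.Injective (Fin.castLE (min_le_right p q)) := Fin.castLE_injective _
      refine le_trans (le_of_eq ?_) ((Finset.sum_map Finset.univ ⟨_, hinj'⟩ fun j : Fin q =>
        ‖(Uᴴ * rectDiag σ) i j‖ ^ 2).symm.le.trans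
          (Finset.sum_le_univ_sum_of_nonneg fun j => sq_nonneg _))
      refine Finset.sum_congr rfl fun k _ => ?_
      simp only [Function.Embedding.coeFn_mk, mul_rectDiag_apply, norm_smul, mul_pow,
        conjTranspose_apply, norm_star, Real.norm_eq_abs, sq_abs]
    · simp only [hi, if_false, mul_zero, Finset.sum_const_zero]
      positivity

section IsQSVD

variable {ι κ γ : Type} [Fintype ι] [Fintype κ] [DecidableEq ι] [DecidableEq κ] [Fintype γ]
  [DecidableEq γ] {p q c : ℕ} {M : Matrix ι κ ℍ} {U : Matrix ι (Fin p) ℍ}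
  {σ : Fin (min p q) → ℝ} {V : Matrix κ (Fin q) ℍ}

/-- The error of the truncated singular value decomposition. -/
lemma nsq_sub_truncation (h : IsQSVD c M U σ V) {f : γ → Fin (min p q)}
    (hf : Function.Injective f) (hfc : ∀ k, k ∈ Set.range f ↔ k.val < c) :
    nsq (M - U.submatrix id (Fin.castLE (min_le_left p q) ∘ f) *
      diagonal (fun g => ((σ (f g) : ℝ) : ℍ)) *
        (V.submatrix id (Fin.castLE (min_le_right p q) ∘ f))ᴴ) =
      ∑ k, (if c ≤ k.val then σ k ^ 2 else 0) := by
  have e1 : Uᴴ * U.submatrix id (Fin.castLE (min_le_left p q) ∘ f) =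
      (1 : Matrix (Fin p) (Fin p) ℍ).submatrix id (Fin.castLE (min_le_left p q) ∘ f) := by
    rw [← h.left_unitary.1]; rfl
  have e2 : (V.submatrix id (Fin.castLE (min_le_right p q) ∘ f))ᴴ * V =
      (1 : Matrix (Fin q) (Fin q) ℍ).submatrix (Fin.castLE (min_le_right p q) ∘ f) id := by
    rw [← h.right_unitary.1]; rfl
  rw [← nsq_unitary_mul (U := Uᴴ) (by simpa using h.left_unitary.2),
    ← nsq_mul_unitary h.right_unitary.2, Matrix.mul_sub, Matrix.sub_mul, h.svd,
    ← Matrix.mul_assoc, ← Matrix.mul_assoc, e1, Matrix.mul_assoc, e2]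
  have e3 : rectDiag σ - (1 : Matrix (Fin p) (Fin p) ℍ).submatrix id
        (Fin.castLE (min_le_left p q) ∘ f) * diagonal (fun g => ((σ (f g) : ℝ) : ℍ)) *
        (1 : Matrix (Fin q) (Fin q) ℍ).submatrix (Fin.castLE (min_le_right p q) ∘ f) id =
      rectDiag fun k : Fin (min p q) => if c ≤ k.val then σ k else 0 := by
    refine Matrix.ext fun i j => ?_
    rw [Matrix.sub_apply, mul_apply]
    simp only [mul_diagonal, submatrix_apply, id, Function.comp_apply,
      one_apply, rectDiag, of_apply]
    by_cases hij : i.val = j.val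
    · set k : Fin (min p q) := ⟨i.val, lt_min i.isLt (hij ▸ j.isLt)⟩ with hk
      by_cases hkc : k.val < c
      · obtain ⟨g, hg⟩ := (hfc k).2 hkc
        rw [Finset.sum_eq_single g]
        · have : ¬ c ≤ i.val := not_le.2 hkc
          simp [hg, hk, Fin.ext_iff, hij, hij ▸ this]
        · intro g' _ hne
          have : i.val ≠ (f g').val := fun h' => hne (hf (by rw [hg]; exact Fin.ext h'.symm))
          simp [Fin.ext_iff, this]
        · simp
      · rw [Finset.sum_eq_zero]
        · have : c ≤ i.val := not_lt.1 hkc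
          simp [hij, hij ▸ this]
        · intro g _
          have : i.val ≠ (f g).val := fun h' =>
            hkc (by have := (hfc (f g)).1 ⟨g, rfl⟩; rw [← h'] at this; exact this)
          simp [Fin.ext_iff, this]
    · rw [Finset.sum_eq_zero]
      · simp [hij]
      · intro g _
        by_cases hi : i.val = (f g).val
        · have : (f g).val ≠ j.val := fun h' => hij (hi.trans h')
          simp [Fin.ext_iff, this]
        · simp [Fin.ext_iff, hi]
  rw [e3, nsq_rectDiag]
  refine Finset.sum_congr rfl fun k _ => ?_
  split_ifs <;> simp

/-- The Eckart–Young theorem for quaternion matrices. -/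
theorem nsq_sub_truncation_le (hc : c < min p q) (h : IsQSVD c M U σ V) {f : γ → Fin (min p q)}
    (hf : Function.Injective f) (hfc : ∀ k, k ∈ Set.range f ↔ k.val < c)
    (X : Matrix ι γ ℍ) (Y : Matrix γ κ ℍ) :
    nsq (M - U.submatrix id (Fin.castLE (min_le_left p q) ∘ f) *
      diagonal (fun g => ((σ (f g) : ℝ) : ℍ)) *
        (V.submatrix id (Fin.castLE (min_le_right p q) ∘ f))ᴴ) ≤ nsq (M - X * Y) := by
  -- The inner index type of X and Y is the one that enumerates the kept components through f.
  have hγ : Fintype.card γ = c := by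
    have h1 : Finset.univ.image f = Finset.univ.filter fun k : Fin (min p q) => k.val < c := by
      ext k; simpa using hfc k
    rw [← Finset.card_univ, ← Finset.card_image_of_injective _ hf, h1, Fin.card_filter_val_lt,
      min_eq_right hc.le]
  rw [nsq_sub_truncation h hf hfc, ← nsq_unitary_mul (U := Uᴴ) (by simpa using h.left_unitary.2)
    (M - X * Y), ← nsq_mul_unitary h.right_unitary.2, Matrix.mul_sub, Matrix.sub_mul, h.svd,
    ← Matrix.mul_assoc, Matrix.mul_assoc]
  exact sum_tail_sq_le_nsq_rectDiag_sub_mul hc h.nonneg h.largest hγ _ _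

end IsQSVD

end

end QuaternionMatrix

namespace QTensor

open Matrix QuaternionMatrix

/-! ### Block circulant matrices and the t-product -/

section

variable {n₁ n₂ n₃ m : ℕ}

lemma bcirc_apply (T : QTensor n₁ n₂ m) (a : Fin m × Fin n₁) (b : Fin m × Fin n₂) :
    bcirc T a b = T a.2 b.2 (a.1 - b.1) := rfl

section Bcirc

variable [NeZero m]

lemma bcirc_injective : Function.Injective (bcirc (n₁ := n₁) (n₂ := n₂) (m := m)) := by
  intro S T h
  funext i j k
  have := congrFun (congrFun h (k, i)) (0, j)
  simpa only [bcirc_apply, sub_zero] using this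

lemma bcirc_tProd (X : QTensor n₁ n₂ m) (Y : QTensor n₂ n₃ m) :
    bcirc (tProd X Y) = bcirc X * bcirc Y := by
  refine Matrix.ext fun a b => ?_
  simp only [bcirc_apply, tProd, fold, mul_apply, unfold, of_apply, Fintype.sum_prod_type]
  -- Substitute u - t for the summation index u, where t is the block column.
  refine (Equiv.sum_comp (Equiv.subRight b.1) _).symm.trans ?_
  simp

lemma bcirc_conjT (X : QTensor n₁ n₂ m) : bcirc (conjT X) = (bcirc X)ᴴ := by
  refine Matrix.ext fun a b => ?_
  simp [bcirc_apply, conjT, conjTranspose_apply]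

lemma bcirc_idTensor : bcirc (idTensor n₁ m) = 1 := by
  refine Matrix.ext fun a b => ?_
  simp [bcirc_apply, idTensor, one_apply, Prod.ext_iff, sub_eq_zero]

lemma tProd_assoc {n₄ : ℕ} (X : QTensor n₁ n₂ m) (Y : QTensor n₂ n₃ m) (Z : QTensor n₃ n₄ m) :
    tProd (tProd X Y) Z = tProd X (tProd Y Z) :=
  bcirc_injective (by simp only [bcirc_tProd, Matrix.mul_assoc])

/-- The slices are read off from block column 0. Shift invariance is the form in which equivariance
of a Fourier transform produces a tensor. -/
lemma exists_bcirc_eq {B : Matrix (Fin m × Fin n₁) (Fin m × Fin n₂) ℍ}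
    (h : ∀ s t c i j, B (s + c, i) (t + c, j) = B (s, i) (t, j)) :
    ∃ T : QTensor n₁ n₂ m, bcirc T = B := by
  refine ⟨fun i j k => B (k, i) (0, j), Matrix.ext fun a b => ?_⟩
  have := h (a.1 - b.1) 0 b.1 a.2 b.2
  rw [sub_add_cancel, zero_add] at this
  exact this.symm

/-- Each of the m block columns contains every frontal slice exactly once. -/
lemma nsq_bcirc (T : QTensor n₁ n₂ m) : nsq (bcirc T) = m * frobNorm T ^ 2 := by
  rw [frobNorm, Real.sq_sqrt (by positivity)]
  simp only [nsq, bcirc_apply]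
  rw [Finset.sum_comm, Fintype.sum_prod_type]
  have : ∀ t : Fin m, ∑ j : Fin n₂, ∑ a : Fin m × Fin n₁, ‖T a.2 j (a.1 - t)‖ ^ 2 =
      ∑ i, ∑ j, ∑ k, ‖T i j k‖ ^ 2 := fun t => by
    rw [Finset.sum_comm (s := (Finset.univ : Finset (Fin n₁)))]
    refine Finset.sum_congr rfl fun j _ => ?_
    rw [Fintype.sum_prod_type, Finset.sum_comm]
    exact Finset.sum_congr rfl fun i _ =>
      Equiv.sum_comp (Equiv.subRight t) fun k => ‖T i j k‖ ^ 2
  simp [this]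

end Bcirc

/-! ### Characters of ℤ/m with values in ℝ[μ], and the Fourier matrix -/

/-- The root of unity `exp (-2 π μ / m)`. -/
def root (m : ℕ) (μ : ℍ) : ℍ := NormedSpace.exp ((-2 * Real.pi / m : ℝ) • μ)

/-- The powers of `root m μ`, indexed by residues. -/
def chi (μ : ℍ) (t : Fin m) : ℍ := root m μ ^ t.val

lemma IsUnitPure.star_eq {μ : ℍ} (hμ : IsUnitPure μ) : star μ = -μ :=
  Quaternion.star_eq_neg.2 hμ.1

lemma IsUnitPure.star_mul_self {μ : ℍ} (hμ : IsUnitPure μ) : star μ * μ = 1 := by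
  rw [star_mul_self_eq_norm_sq, hμ.2]; simp

lemma IsUnitPure.mul_self {μ : ℍ} (hμ : IsUnitPure μ) : μ * μ = -1 := by
  have := hμ.star_mul_self
  rw [hμ.star_eq, neg_mul] at this
  rw [← this, neg_neg]

/-- The embedding of the complex numbers that maps `I` to `μ`. -/
def complexEmb {μ : ℍ} (hμ : IsUnitPure μ) : ℂ →ₐ[ℝ] ℍ := Complex.lift ⟨μ, hμ.mul_self⟩

lemma complexEmb_apply {μ : ℍ} (hμ : IsUnitPure μ) (z : ℂ) :
    complexEmb hμ z = (z.re : ℍ) + z.im • μ := by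
  simp only [complexEmb, Complex.lift_apply, Complex.liftAux_apply]
  rfl

/-- Transport to ℂ along the injective embedding with I ↦ μ, which makes the primitivity of the
complex root available in ℍ. -/
lemma root_eq {μ : ℍ} (hμ : IsUnitPure μ) (m : ℕ) :
    root m μ = complexEmb hμ (Complex.exp (2 * Real.pi * Complex.I / m))⁻¹ := by
  have hc : Continuous (complexEmb hμ) :=
    (complexEmb hμ).toLinearMap.continuous_of_finiteDimensional
  rw [← Complex.exp_neg, Complex.exp_eq_exp_ℂ, NormedSpace.map_exp (complexEmb hμ) hc, root]
  congr 1
  have e : -(2 * Real.pi * Complex.I / m) = (-2 * Real.pi / m : ℝ) • Complex.I := by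
    rw [Complex.real_smul]; push_cast; ring
  rw [e, map_smul, complexEmb_apply]
  simp

section Chi

variable [NeZero m] {μ : ℍ}

lemma root_pow_self (hμ : IsUnitPure μ) : root m μ ^ m = 1 := by
  rw [root_eq hμ, ← map_pow, ((Complex.isPrimitiveRoot_exp m (NeZero.ne m)).inv).pow_eq_one,
    map_one]

lemma chi_add (hμ : IsUnitPure μ) (s t : Fin m) : chi μ (s + t) = chi μ s * chi μ t := by
  rw [chi, chi, chi, Fin.val_add, ← pow_add]
  exact (pow_eq_pow_mod _ (root_pow_self hμ)).symm

lemma chi_zero : chi μ (0 : Fin m) = 1 := by simp [chi]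

lemma chi_commute (s t : Fin m) : Commute (chi μ s) (chi μ t) := Commute.pow_pow_self _ _ _

lemma chi_injective (hμ : IsUnitPure μ) : Function.Injective (chi μ : Fin m → ℍ) := fun s t h => by
  rw [chi, chi, root_eq hμ, ← map_pow, ← map_pow] at h
  exact Fin.ext ((Complex.isPrimitiveRoot_exp m (NeZero.ne m)).inv.pow_inj s.isLt t.isLt
    ((complexEmb hμ).toRingHom.injective h))

lemma star_root_mul_self (hμ : IsUnitPure μ) : star (root m μ) * root m μ = 1 := by
  have h := congrArg norm (root_pow_self (m := m) hμ)
  rw [norm_pow, norm_one, pow_eq_one_iff_of_nonneg (norm_nonneg _) (NeZero.ne m)] at h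
  rw [star_mul_self_eq_norm_sq, h, one_pow, Quaternion.coe_one]

lemma star_chi_mul_self (hμ : IsUnitPure μ) (t : Fin m) : star (chi μ t) * chi μ t = 1 := by
  have h : ∀ n : ℕ, star (root m μ ^ n) * root m μ ^ n = 1 := fun n => by
    induction n with
    | zero => simp
    | succ n ih =>
      rw [pow_succ', star_mul, mul_assoc, ← mul_assoc (star (root m μ)), star_root_mul_self hμ,
        one_mul, ih]
  exact h _

lemma star_chi (hμ : IsUnitPure μ) (t : Fin m) : star (chi μ t) = chi μ (-t) := by
  have h1 : chi μ t * chi μ (-t) = 1 := by rw [← chi_add hμ, add_neg_cancel, chi_zero]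
  calc star (chi μ t) = star (chi μ t) * (chi μ t * chi μ (-t)) := by rw [h1, mul_one]
    _ = _ := by rw [← mul_assoc, star_chi_mul_self hμ, one_mul]

lemma chi_eq (hμ : IsUnitPure μ) (t : Fin m) : ∃ a b : ℝ, chi μ t = (a : ℍ) + b • μ := by
  rw [chi, root_eq hμ, ← map_pow, complexEmb_apply]
  exact ⟨_, _, rfl⟩

/-- The bicharacter `(u, v) ↦ exp (-2 π μ / m) ^ (u v)`. -/
def psi (μ : ℍ) (u v : Fin m) : ℍ := chi μ u ^ v.val

lemma psi_comm (u v : Fin m) : psi μ u v = psi μ v u := by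
  rw [psi, psi, chi, chi, ← pow_mul, ← pow_mul, mul_comm]

lemma psi_add_left (hμ : IsUnitPure μ) (u u' v : Fin m) :
    psi μ (u + u') v = psi μ u v * psi μ u' v := by
  rw [psi, chi_add hμ, (chi_commute u u').mul_pow]; rfl

lemma psi_add_right (hμ : IsUnitPure μ) (u v v' : Fin m) :
    psi μ u (v + v') = psi μ u v * psi μ u v' := by
  rw [psi_comm, psi_add_left hμ, psi_comm v, psi_comm v']

lemma psi_commute (u v u' v' : Fin m) : Commute (psi μ u v) (psi μ u' v') :=
  (chi_commute u u').pow_pow _ _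

lemma star_psi (hμ : IsUnitPure μ) (u v : Fin m) : star (psi μ u v) = psi μ (-u) v := by
  rw [psi, star_pow, star_chi hμ]; rfl

lemma psi_one_right (u : Fin m) : psi μ u 1 = chi μ u := by
  rw [psi]
  obtain rfl | h : m = 1 ∨ m ≠ 1 := em _
  · obtain rfl : u = 0 := Subsingleton.elim _ _
    simp [chi_zero]
  · have : 1 < m := by have := NeZero.pos m; omega
    rw [Fin.val_one' , Nat.mod_eq_of_lt this, pow_one]

/-- Shifting v by one multiplies the sum by `chi μ d`, which differs from 1 unless d = 0. -/
lemma sum_psi (hμ : IsUnitPure μ) (d : Fin m) :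
    ∑ v, psi μ d v = if d = 0 then (m : ℍ) else 0 := by
  split_ifs with h
  · subst h; simp [psi, chi_zero]
  · have h1 : (∑ v, psi μ d v) * chi μ d = ∑ v, psi μ d v := by
      rw [Finset.sum_mul, ← Equiv.sum_comp (Equiv.addRight (1 : Fin m)) (psi μ d)]
      exact Finset.sum_congr rfl fun v _ => by
        rw [Equiv.coe_addRight, psi_add_right hμ, psi_one_right]
    have h2 : chi μ d ≠ 1 := fun h' => h (chi_injective hμ (h'.trans chi_zero.symm))
    rw [← sub_eq_zero, ← mul_sub_one, mul_eq_zero] at h1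
    exact h1.resolve_right (sub_ne_zero.2 h2)

lemma qft_apply (u v : Fin m) : qft m μ u v = (1 / Real.sqrt m : ℝ) • psi μ u v := by
  rw [psi, chi, ← pow_mul]; rfl

lemma qft_comm (u v : Fin m) : qft m μ u v = qft m μ v u := by
  rw [qft_apply, psi_comm, ← qft_apply]

lemma qft_mul_conjTranspose (hμ : IsUnitPure μ) : qft m μ * (qft m μ)ᴴ = 1 := by
  refine Matrix.ext fun a b => ?_
  have hm : (0 : ℝ) < m := by exact_mod_cast NeZero.pos m
  have h : ∀ v, qft m μ a v * star (qft m μ b v) = (m : ℝ)⁻¹ • psi μ (a - b) v := fun v => by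
    rw [qft_apply, qft_apply, Quaternion.star_smul, smul_mul_smul_comm, star_psi hμ, sub_eq_add_neg,
      psi_add_left hμ, one_div, ← mul_inv, Real.mul_self_sqrt hm.le]
  simp only [mul_apply, conjTranspose_apply, h, ← Finset.smul_sum, sum_psi hμ, sub_eq_zero,
    one_apply]
  split_ifs
  · rw [← Quaternion.coe_natCast, Quaternion.smul_coe, inv_mul_cancel₀ hm.ne']; simp
  · simp

/-- The Fourier matrix is symmetric and its entries lie in the commutative algebra ℝ[μ], so this
product has the entries of the opposite product with the indices exchanged. -/
lemma conjTranspose_mul_qft (hμ : IsUnitPure μ) : (qft m μ)ᴴ * qft m μ = 1 := by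
  refine Matrix.ext fun a b => ?_
  have hab := congrFun (congrFun (qft_mul_conjTranspose (m := m) hμ) b) a
  rw [mul_apply] at hab ⊢
  rw [show (1 : Matrix (Fin m) (Fin m) ℍ) a b = (1 : Matrix (Fin m) (Fin m) ℍ) b a by
    simp [one_apply, eq_comm], ← hab]
  refine Finset.sum_congr rfl fun u _ => ?_
  rw [conjTranspose_apply, conjTranspose_apply, qft_comm u a, qft_comm u b, qft_apply, qft_apply,
    Quaternion.star_smul, star_psi hμ]
  exact (((psi_commute _ _ _ _).smul_left _).smul_right _).eq

end Chi

section Kronecker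

variable {α β γ : Type*} [Fintype β]

/-- The mixed-product rule fails for general quaternion matrices; it holds here because the entries
of the identity are central. -/
lemma kronecker_one_mul (A : Matrix α β ℍ) (B : Matrix β γ ℍ) (n : ℕ) :
    (A ⊗ₖ (1 : Matrix (Fin n) (Fin n) ℍ)) * (B ⊗ₖ (1 : Matrix (Fin n) (Fin n) ℍ)) =
      (A * B) ⊗ₖ (1 : Matrix (Fin n) (Fin n) ℍ) := by
  refine Matrix.ext fun a b => ?_
  simp [mul_apply, kroneckerMap_apply, Fintype.sum_prod_type, one_apply]

lemma conjTranspose_kronecker_one (A : Matrix α β ℍ) (n : ℕ) :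
    (A ⊗ₖ (1 : Matrix (Fin n) (Fin n) ℍ))ᴴ = Aᴴ ⊗ₖ (1 : Matrix (Fin n) (Fin n) ℍ) := by
  refine Matrix.ext fun a b => ?_
  simp [kroneckerMap_apply, one_apply, eq_comm, apply_ite star]

end Kronecker

/-! ### The block Fourier transform and equivariance -/

section Fourier

variable [NeZero m] {μ : ℍ}

/-- The block Fourier matrix `F ⊗ I`. -/
def blockQft (m n : ℕ) (μ : ℍ) : Matrix (Fin m × Fin n) (Fin m × Fin n) ℍ :=
  qft m μ ⊗ₖ (1 : Matrix (Fin n) (Fin n) ℍ)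

lemma blockQft_mul_conjTranspose (hμ : IsUnitPure μ) (n : ℕ) :
    blockQft m n μ * (blockQft m n μ)ᴴ = 1 := by
  rw [blockQft, conjTranspose_kronecker_one, kronecker_one_mul, qft_mul_conjTranspose hμ,
    one_kronecker_one]

lemma conjTranspose_mul_blockQft (hμ : IsUnitPure μ) (n : ℕ) :
    (blockQft m n μ)ᴴ * blockQft m n μ = 1 := by
  rw [blockQft, conjTranspose_kronecker_one, kronecker_one_mul, conjTranspose_mul_qft hμ,
    one_kronecker_one]

lemma toFourier_eq (A : Matrix (Fin m × Fin n₁) (Fin m × Fin n₂) ℍ) :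
    toFourier μ A = blockQft m n₁ μ * A * (blockQft m n₂ μ)ᴴ := by
  rw [toFourier, blockQft, blockQft, conjTranspose_kronecker_one]

lemma fromFourier_eq (A : Matrix (Fin m × Fin n₁) (Fin m × Fin n₂) ℍ) :
    fromFourier μ A = (blockQft m n₁ μ)ᴴ * A * blockQft m n₂ μ := by
  rw [fromFourier, blockQft, blockQft, conjTranspose_kronecker_one]

lemma toFourier_fromFourier (hμ : IsUnitPure μ)
    (A : Matrix (Fin m × Fin n₁) (Fin m × Fin n₂) ℍ) : toFourier μ (fromFourier μ A) = A := by
  rw [toFourier_eq, fromFourier_eq, Matrix.mul_assoc, Matrix.mul_assoc,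
    blockQft_mul_conjTranspose hμ, Matrix.mul_one, ← Matrix.mul_assoc,
    blockQft_mul_conjTranspose hμ, Matrix.one_mul]

lemma fromFourier_toFourier (hμ : IsUnitPure μ)
    (A : Matrix (Fin m × Fin n₁) (Fin m × Fin n₂) ℍ) : fromFourier μ (toFourier μ A) = A := by
  rw [toFourier_eq, fromFourier_eq, Matrix.mul_assoc, Matrix.mul_assoc,
    conjTranspose_mul_blockQft hμ, Matrix.mul_one, ← Matrix.mul_assoc,
    conjTranspose_mul_blockQft hμ, Matrix.one_mul]

lemma toFourier_mul (hμ : IsUnitPure μ) (A : Matrix (Fin m × Fin n₁) (Fin m × Fin n₂) ℍ)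
    (B : Matrix (Fin m × Fin n₂) (Fin m × Fin n₃) ℍ) :
    toFourier μ (A * B) = toFourier μ A * toFourier μ B := by
  simp only [toFourier_eq, Matrix.mul_assoc]
  rw [← Matrix.mul_assoc (blockQft m n₂ μ)ᴴ, conjTranspose_mul_blockQft hμ, Matrix.one_mul]

lemma toFourier_conjTranspose (A : Matrix (Fin m × Fin n₁) (Fin m × Fin n₂) ℍ) :
    toFourier μ Aᴴ = (toFourier μ A)ᴴ := by
  simp only [toFourier_eq, conjTranspose_mul, conjTranspose_conjTranspose, Matrix.mul_assoc]

lemma toFourier_sub (A B : Matrix (Fin m × Fin n₁) (Fin m × Fin n₂) ℍ) :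
    toFourier μ (A - B) = toFourier μ A - toFourier μ B := by
  simp only [toFourier_eq, Matrix.mul_sub, Matrix.sub_mul]

lemma toFourier_one (hμ : IsUnitPure μ) :
    toFourier μ (1 : Matrix (Fin m × Fin n₁) (Fin m × Fin n₁) ℍ) = 1 := by
  rw [toFourier_eq, Matrix.mul_one, blockQft_mul_conjTranspose hμ]

lemma nsq_toFourier (hμ : IsUnitPure μ) (A : Matrix (Fin m × Fin n₁) (Fin m × Fin n₂) ℍ) :
    nsq (toFourier μ A) = nsq A := by
  rw [toFourier_eq, nsq_mul_unitary, nsq_unitary_mul (conjTranspose_mul_blockQft hμ n₁)]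
  rw [conjTranspose_conjTranspose, conjTranspose_mul_blockQft hμ]

lemma toFourier_injective (hμ : IsUnitPure μ) :
    Function.Injective (toFourier μ (m := m) (a := n₁) (b := n₂)) :=
  Function.LeftInverse.injective (fromFourier_toFourier hμ)

lemma toFourier_apply (A : Matrix (Fin m × Fin n₁) (Fin m × Fin n₂) ℍ) (s t : Fin m) (i : Fin n₁)
    (j : Fin n₂) : toFourier μ A (s, i) (t, j) =
      ∑ v, ∑ u, qft m μ s u * A (u, i) (v, j) * star (qft m μ t v) := by
  simp [toFourier, mul_apply, kroneckerMap_apply, Fintype.sum_prod_type, one_apply,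
    Finset.sum_mul]

lemma fromFourier_apply (A : Matrix (Fin m × Fin n₁) (Fin m × Fin n₂) ℍ) (u v : Fin m) (i : Fin n₁)
    (j : Fin n₂) : fromFourier μ A (u, i) (v, j) =
      ∑ t, ∑ s, star (qft m μ s u) * A (s, i) (t, j) * qft m μ t v := by
  simp [fromFourier, mul_apply, kroneckerMap_apply, Fintype.sum_prod_type, one_apply,
    Finset.sum_mul]

/-- The matrices that intertwine the powers of the root of unity; these are the Fourier transforms
of the block circulant matrices. -/
def IsEquivariant {n₁ n₂ : ℕ} (μ : ℍ) (A : Matrix (Fin m × Fin n₁) (Fin m × Fin n₂) ℍ) : Prop :=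
  ∀ s t i j, chi μ s * A (s, i) (t, j) = A (s, i) (t, j) * chi μ t

lemma qft_add_right (hμ : IsUnitPure μ) (u v c : Fin m) :
    qft m μ u (v + c) = psi μ u c * qft m μ u v := by
  rw [qft_apply, qft_apply, psi_add_right hμ, mul_smul_comm, (psi_commute u v u c).eq]

/-- A block circulant matrix is invariant under the simultaneous shift of its block indices.
Shifting both Fourier sums by one produces χ_s on the left and trades it for χ_t on the right. Since
these factors sit on opposite sides of a quaternion, they do not force s = t. -/
lemma isEquivariant_toFourier_bcirc (hμ : IsUnitPure μ) (T : QTensor n₁ n₂ m) :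
    IsEquivariant μ (toFourier μ (bcirc T)) := by
  intro s t i j
  have h1 : ∀ u, chi μ s * qft m μ s u = qft m μ s (u + 1) := fun u => by
    rw [qft_add_right hμ, psi_one_right]
  have h2 : ∀ v, star (qft m μ t (v + 1)) * chi μ t = star (qft m μ t v) := fun v => by
    rw [qft_add_right hμ, psi_one_right, qft_apply, star_mul, mul_assoc,
      star_chi_mul_self hμ, mul_one]
  rw [toFourier_apply, Finset.mul_sum, Finset.sum_mul]
  refine Eq.trans ?_ (Equiv.sum_comp (Equiv.addRight (1 : Fin m)) _)
  refine Finset.sum_congr rfl fun v _ => ?_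
  rw [Finset.mul_sum, Finset.sum_mul]
  refine Eq.trans ?_ (Equiv.sum_comp (Equiv.addRight (1 : Fin m)) _)
  refine Finset.sum_congr rfl fun u _ => ?_
  simp only [Equiv.coe_addRight, bcirc_apply, add_sub_add_right_eq_sub]
  rw [mul_assoc _ _ (chi μ t), h2, ← mul_assoc, ← mul_assoc, h1]

/-- Equivariance passes to powers: A_{s,t} χ_t^c = χ_s^c A_{s,t}. A shift of both block indices by c
therefore produces the factor star (χ_s^c) χ_s^c = 1. -/
lemma IsEquivariant.exists_bcirc_eq (hμ : IsUnitPure μ)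
    {A : Matrix (Fin m × Fin n₁) (Fin m × Fin n₂) ℍ} (hA : IsEquivariant μ A) :
    ∃ T : QTensor n₁ n₂ m, bcirc T = fromFourier μ A := by
  refine QTensor.exists_bcirc_eq fun u v c i j => ?_
  rw [fromFourier_apply, fromFourier_apply]
  refine Finset.sum_congr rfl fun t _ => Finset.sum_congr rfl fun s _ => ?_
  have h : SemiconjBy (A (s, i) (t, j)) (psi μ t c) (psi μ s c) :=
    SemiconjBy.pow_right (hA s t i j).symm c.val
  have h1 : star (psi μ s c) * psi μ s c = 1 := by
    rw [star_psi hμ, ← psi_add_left hμ, neg_add_cancel, psi, chi_zero, one_pow]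
  rw [qft_add_right hμ, qft_add_right hμ, star_mul]
  calc _ = star (qft m μ s u) * (star (psi μ s c) * (A (s, i) (t, j) * psi μ t c)) *
        qft m μ t v := by
        simp only [mul_assoc]
    _ = _ := by rw [h.eq, ← mul_assoc (star (psi μ s c)), h1, one_mul]

end Fourier

end

/-! ### Decomposition into the blocks of t and -t, and optimality of the truncation -/

section

variable {n₁ n₂ n₃ m r : ℕ} [NeZero m] {μ : ℍ}

/-- Block matrices that vanish outside the blocks `(t, t)` and `(t, -t)`. -/
def IsSupported {a b : ℕ} (A : Matrix (Fin m × Fin a) (Fin m × Fin b) ℍ) : Prop :=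
  ∀ s t i j, s ≠ t → s ≠ -t → A (s, i) (t, j) = 0

/-- An element that intertwines two powers of the root of unity vanishes, unless these powers are
equal or conjugate. -/
lemma eq_or_eq_neg_of_chi_mul_eq (hμ : IsUnitPure μ) {s t : Fin m} {q : ℍ} (hq : q ≠ 0)
    (h : chi μ s * q = q * chi μ t) : s = t ∨ s = -t := by
  have hs : chi μ (-s) * chi μ s = 1 := by rw [← chi_add hμ, neg_add_cancel, chi_zero]
  have ht : chi μ t * chi μ (-t) = 1 := by rw [← chi_add hμ, add_neg_cancel, chi_zero]
  -- The conjugate roots are intertwined too. The sums χ + χ̄ are real, hence central, so q cancels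
  -- and the real parts of χ_s and χ_t agree.
  have h' : chi μ (-s) * q = q * chi μ (-t) := by
    calc chi μ (-s) * q = chi μ (-s) * (q * chi μ t) * chi μ (-t) := by
          rw [mul_assoc, mul_assoc q, ht, mul_one]
      _ = _ := by rw [← h, ← mul_assoc, hs, one_mul]
  have hre : ∀ u : Fin m, chi μ u + chi μ (-u) = ((2 * (chi μ u).re : ℝ) : ℍ) := fun u => by
    rw [← star_chi hμ, Quaternion.self_add_star']
  have h1 : ((2 * (chi μ s).re : ℝ) : ℍ) * q = ((2 * (chi μ t).re : ℝ) : ℍ) * q := by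
    rw [Quaternion.coe_commutes (2 * (chi μ t).re), ← hre, ← hre, add_mul, mul_add, h, h']
  have h2 := mul_right_cancel₀ hq h1
  rw [← hre, ← hre] at h2
  -- In the commutative algebra ℝ[μ], χ_s is a root of the real quadratic polynomial with roots χ_t
  -- and χ_{-t}.
  have h3 : (chi μ s - chi μ t) * (chi μ s - chi μ (-t)) = 0 := by
    have e : chi μ (-t) = chi μ s + chi μ (-s) - chi μ t := by rw [h2]; abel
    have e2 : chi μ s - chi μ (-t) = chi μ t - chi μ (-s) := by rw [e]; abel
    rw [sub_mul, e2, mul_sub, ← e2, mul_sub, ht, (chi_commute s t).eq, (chi_commute s (-s)).eq, hs]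
    abel
  rcases mul_eq_zero.1 h3 with h4 | h4
  · exact Or.inl (chi_injective hμ (sub_eq_zero.1 h4))
  · exact Or.inr (chi_injective hμ (sub_eq_zero.1 h4))

lemma IsEquivariant.isSupported (hμ : IsUnitPure μ)
    {A : Matrix (Fin m × Fin n₁) (Fin m × Fin n₂) ℍ} (hA : IsEquivariant μ A) : IsSupported A :=
  fun s t i j h1 h2 => by
    by_contra h
    exact (eq_or_eq_neg_of_chi_mul_eq hμ h (hA s t i j)).elim h1 h2

namespace IsSupported

lemma conjTranspose {A : Matrix (Fin m × Fin n₁) (Fin m × Fin n₂) ℍ} (hA : IsSupported A) :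
    IsSupported Aᴴ := fun s t i j h1 h2 => by
  rw [conjTranspose_apply, hA t s j i h1.symm (fun h => h2 (by rw [h, neg_neg])), star_zero]

lemma sub {A B : Matrix (Fin m × Fin n₁) (Fin m × Fin n₂) ℍ} (hA : IsSupported A)
    (hB : IsSupported B) : IsSupported (A - B) := fun s t i j h1 h2 => by
  rw [Matrix.sub_apply, hA s t i j h1 h2, hB s t i j h1 h2, sub_zero]

lemma mul {A : Matrix (Fin m × Fin n₁) (Fin m × Fin n₂) ℍ}
    {B : Matrix (Fin m × Fin n₂) (Fin m × Fin n₃) ℍ} (hA : IsSupported A) (hB : IsSupported B) :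
    IsSupported (A * B) := fun s t i j h1 h2 => by
  rw [mul_apply]
  refine Finset.sum_eq_zero fun u _ => ?_
  obtain ⟨u, k⟩ := u
  by_cases hs : s = u
  · subst hs; rw [hB s t k j h1 h2, mul_zero]
  by_cases hs' : s = -u
  · have : u ≠ t := fun h => h2 (by rw [hs', h])
    have h' : u ≠ -t := fun h => h1 (by rw [hs', h, neg_neg])
    rw [hB u t k j this h', mul_zero]
  · rw [hA s u i k hs hs', zero_mul]

lemma one : IsSupported (1 : Matrix (Fin m × Fin n₁) (Fin m × Fin n₁) ℍ) :=
  fun s t i j h1 _ => by simp [one_apply, h1]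

end IsSupported

/-- The four blocks with indices `t` and `-t`. -/
def pairOf {a b : ℕ} (A : Matrix (Fin m × Fin a) (Fin m × Fin b) ℍ) (t : Fin m) :
    Matrix (Fin a ⊕ Fin a) (Fin b ⊕ Fin b) ℍ :=
  A.submatrix (Sum.elim (fun i => (t, i)) fun i => (-t, i))
    (Sum.elim (fun i => (t, i)) fun i => (-t, i))

lemma pairBlock_eq (T : QTensor n₁ n₂ m) (t : Fin m) :
    pairBlock μ T t = pairOf (toFourier μ (bcirc T)) t := by
  refine Matrix.ext fun a b => ?_
  rcases a with a | a <;> rcases b with b | b <;> rfl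

lemma block_mul {A : Matrix (Fin m × Fin n₁) (Fin m × Fin n₂) ℍ} (hA : IsSupported A)
    (B : Matrix (Fin m × Fin n₂) (Fin m × Fin n₃) ℍ) {t : Fin m} (ht : t = -t) :
    block (A * B) t t = block A t t * block B t t := by
  refine Matrix.ext fun i j => ?_
  simp only [block, of_apply, mul_apply]
  rw [Fintype.sum_prod_type, Finset.sum_eq_single t]
  · intro u _ hu
    refine Finset.sum_eq_zero fun k _ => ?_
    rw [hA t u i k hu.symm (fun h => hu (by rw [← neg_neg u, ← h, ← ht])), zero_mul]
  · simp

/-- In the rows ±t a supported left factor has nonzero blocks only in the columns ±t, so no other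
frequency enters; the right factor may be arbitrary. -/
lemma pairOf_mul {A : Matrix (Fin m × Fin n₁) (Fin m × Fin n₂) ℍ} (hA : IsSupported A)
    (B : Matrix (Fin m × Fin n₂) (Fin m × Fin n₃) ℍ) {t : Fin m} (ht : t ≠ -t) :
    pairOf (A * B) t = pairOf A t * pairOf B t := by
  refine Matrix.ext fun x y => ?_
  have key : ∀ s i, (s = t ∨ s = -t) → ∀ b, (A * B) (s, i) b =
      ∑ k, A (s, i) (t, k) * B (t, k) b + ∑ k, A (s, i) (-t, k) * B (-t, k) b := by
    intro s i hs b
    rw [mul_apply, Fintype.sum_prod_type,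
      Fintype.sum_eq_add t (-t) ht]
    rintro u ⟨h1, h2⟩
    refine Finset.sum_eq_zero fun k _ => ?_
    rw [hA s u i k, zero_mul]
    · rintro rfl; exact hs.elim h1 h2
    · rintro rfl
      rcases hs with h | h
      · exact h2 (by rw [← h, neg_neg])
      · exact h1 (neg_injective h)
  rw [mul_apply, Fintype.sum_sum_type]
  rcases x with i | i
  · exact key t i (Or.inl rfl) _
  · exact key (-t) i (Or.inr rfl) _

lemma pairOf_conjTranspose (A : Matrix (Fin m × Fin n₁) (Fin m × Fin n₂) ℍ) (t : Fin m) :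
    pairOf Aᴴ t = (pairOf A t)ᴴ := rfl

lemma block_conjTranspose (A : Matrix (Fin m × Fin n₁) (Fin m × Fin n₂) ℍ) (t : Fin m) :
    block Aᴴ t t = (block A t t)ᴴ := rfl

lemma nsq_pairOf_neg (A : Matrix (Fin m × Fin n₁) (Fin m × Fin n₂) ℍ) (t : Fin m) :
    nsq (pairOf A (-t)) = nsq (pairOf A t) := by
  rw [← nsq_submatrix (pairOf A t) (Equiv.sumComm _ _) (Equiv.sumComm _ _)]
  congr 1
  refine Matrix.ext fun a b => ?_
  rcases a with a | a <;> rcases b with b | b <;> simp [pairOf]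

/-- Doubling lets the sum run over all t instead of over representatives: each pair block is counted
at t and at -t, and a single block receives the factor 2. -/
lemma two_mul_nsq {A : Matrix (Fin m × Fin n₁) (Fin m × Fin n₂) ℍ} (hA : IsSupported A) :
    2 * nsq A = ∑ t, if t = -t then 2 * nsq (block A t t) else nsq (pairOf A t) := by
  have h0 : ∀ s t, s ≠ t → s ≠ -t → nsq (block A s t) = 0 := fun s t h1 h2 => by
    simp [nsq, block, hA s t _ _ h1 h2]
  have h1 : nsq A = ∑ s, ∑ t, nsq (block A s t) := by
    simp only [nsq, Fintype.sum_prod_type]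
    exact Finset.sum_congr rfl fun s _ => Finset.sum_comm
  have h2 : nsq A = ∑ s, ∑ t, nsq (block A (-s) t) := by
    rw [h1, ← Equiv.sum_comp (Equiv.neg (Fin m))]; rfl
  have h3 : 2 * nsq A = ∑ s, (∑ t, nsq (block A s t) + ∑ t, nsq (block A (-s) t)) := by
    rw [Finset.sum_add_distrib, ← h1, ← h2, two_mul]
  rw [h3]
  refine Finset.sum_congr rfl fun s _ => ?_
  split_ifs with hs
  · rw [← hs, ← two_mul, Fintype.sum_eq_single s]
    exact fun t ht => h0 s t ht.symm fun h => ht (by rw [← neg_neg t, ← h, ← hs])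
  · rw [Fintype.sum_eq_add s (-s) hs, Fintype.sum_eq_add s (-s) hs]
    · simp only [nsq, pairOf, block, Fintype.sum_sum_type, submatrix_apply, of_apply, Sum.elim_inl,
        Sum.elim_inr, Finset.sum_add_distrib]
      ring
    · rintro t ⟨h1, h2⟩
      exact h0 _ _ (Ne.symm h2) fun h => h1 (neg_injective h).symm
    · rintro t ⟨h1, h2⟩
      exact h0 _ _ (Ne.symm h1) fun h => h2 (by rw [h, neg_neg])

/-- The third case is the second one for -t, so that hypotheses about representatives t < -t apply
to -t. -/
lemma lt_trichotomy_neg (t : Fin m) : t = -t ∨ t < -t ∨ -t < - -t := by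
  rw [neg_neg]
  exact (lt_trichotomy t (-t)).elim (fun h => Or.inr (Or.inl h)) fun h =>
    h.elim Or.inl fun h => Or.inr (Or.inr h)

lemma nsq_le_nsq_of_blocks {A B : Matrix (Fin m × Fin n₁) (Fin m × Fin n₂) ℍ} (hA : IsSupported A)
    (hB : IsSupported B) (h1 : ∀ t : Fin m, t = -t → nsq (block A t t) ≤ nsq (block B t t))
    (h2 : ∀ t : Fin m, t < -t → nsq (pairOf A t) ≤ nsq (pairOf B t)) : nsq A ≤ nsq B := by
  have h : 2 * nsq A ≤ 2 * nsq B := by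
    rw [two_mul_nsq hA, two_mul_nsq hB]
    refine Finset.sum_le_sum fun t _ => ?_
    split_ifs with ht
    · linarith [h1 t ht]
    · rcases lt_trichotomy_neg t with h | h | h
      · exact absurd h ht
      · exact h2 t h
      · rw [← nsq_pairOf_neg A, ← nsq_pairOf_neg B]
        exact h2 _ h
  linarith

lemma ext_of_blocks {A B : Matrix (Fin m × Fin n₁) (Fin m × Fin n₂) ℍ} (hA : IsSupported A)
    (hB : IsSupported B) (h1 : ∀ t : Fin m, t = -t → block A t t = block B t t)
    (h2 : ∀ t : Fin m, t < -t → pairOf A t = pairOf B t) : A = B := by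
  refine Matrix.ext fun ⟨s, i⟩ ⟨t, j⟩ => ?_
  by_cases hst : s = t ∨ s = -t
  · rcases lt_trichotomy_neg t with h | h | h
    · rw [← h, or_self] at hst
      subst hst
      exact congrFun (congrFun (h1 s h) i) j
    · rcases hst with rfl | rfl
      · exact congrFun (congrFun (h2 _ h) (Sum.inl i)) (Sum.inl j)
      · exact congrFun (congrFun (h2 _ h) (Sum.inr i)) (Sum.inl j)
    · have h' := h2 _ h
      rcases hst with rfl | rfl
      · simpa [pairOf] using congrFun (congrFun h' (Sum.inr i)) (Sum.inr j)
      · simpa [pairOf] using congrFun (congrFun h' (Sum.inl i)) (Sum.inr j)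
  · rw [not_or] at hst
    rw [hA s t i j hst.1 hst.2, hB s t i j hst.1 hst.2]

/-- The position in `Fin N` of the components kept in a pair block. -/
def pairIndex {r N : ℕ} (h : 2 * r ≤ N) : Fin r ⊕ Fin r → Fin N :=
  Sum.elim (fun j => ⟨j, by omega⟩) fun j => ⟨r + j, by omega⟩

lemma pairIndex_injective {N : ℕ} (h : 2 * r ≤ N) : Function.Injective (pairIndex h) := by
  rintro (a | a) (b | b) hab <;> simp [pairIndex, Fin.ext_iff] at hab ⊢ <;> omega

lemma mem_range_pairIndex {N : ℕ} (h : 2 * r ≤ N) (k : Fin N) :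
    k ∈ Set.range (pairIndex h) ↔ k.val < 2 * r := by
  constructor
  · rintro ⟨a | a, rfl⟩ <;> simp [pairIndex] <;> omega
  · intro hk
    by_cases hr : k.val < r
    · exact ⟨Sum.inl ⟨k, hr⟩, rfl⟩
    · exact ⟨Sum.inr ⟨k - r, by omega⟩, Fin.ext (by simp [pairIndex]; omega)⟩

section Truncation

variable {n : ℕ} (h : r ≤ n) (U₁ : Fin m → Matrix (Fin n) (Fin n) ℍ)
  (U₂ : Fin m → Matrix (Fin n ⊕ Fin n) (Fin (2 * n)) ℍ)

lemma isSupported_truncFactor : IsSupported (truncFactor h U₁ U₂) := fun s t i j h1 h2 => by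
  simp [truncFactor, h1, h2]

lemma block_truncFactor {t : Fin m} (ht : t = -t) :
    block (truncFactor h U₁ U₂) t t = (U₁ t).submatrix id (Fin.castLE h) := by
  refine Matrix.ext fun i j => ?_
  simp only [block, truncFactor, of_apply, if_pos ht, if_true, submatrix_apply]
  rfl

lemma pairOf_truncFactor {t : Fin m} (ht : t < -t) :
    pairOf (truncFactor h U₁ U₂) t =
      (U₂ t).submatrix id (pairIndex (Nat.mul_le_mul_left 2 h)) := by
  refine Matrix.ext fun i j => ?_
  have h1 : t ≠ -t := ht.ne
  have h2 : -t ≠ t := ht.ne'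
  have h3 : ¬ -t < t := ht.not_gt
  rcases i with i | i <;> rcases j with j | j <;>
    simp [pairOf, truncFactor, pairIndex, h1, h2, h3, ht]

end Truncation

section TruncSigma

variable (h : r ≤ min n₁ n₂) (σ₁ : Fin m → Fin (min n₁ n₂) → ℝ)
  (σ₂ : Fin m → Fin (min (2 * n₁) (2 * n₂)) → ℝ)

lemma isSupported_truncSigma : IsSupported (truncSigma h σ₁ σ₂) := fun s t i j h1 _ => by
  rw [truncSigma, diagonal_apply_ne]
  simp [h1]

lemma block_truncSigma {t : Fin m} (ht : t = -t) :
    block (truncSigma h σ₁ σ₂) t t =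
      diagonal fun j => ((σ₁ t (Fin.castLE h j) : ℝ) : ℍ) := by
  refine Matrix.ext fun i j => ?_
  simp only [block, truncSigma, of_apply, diagonal_apply, Prod.mk.injEq, true_and, if_pos ht]
  rfl

lemma pairOf_truncSigma {t : Fin m} (ht : t < -t) :
    pairOf (truncSigma h σ₁ σ₂) t =
      diagonal fun g => ((σ₂ t (pairIndex (by omega) g) : ℝ) : ℍ) := by
  refine Matrix.ext fun i j => ?_
  have h1 : t ≠ -t := ht.ne
  have h2 : -t ≠ t := ht.ne'
  have h3 : ¬ -t < t := ht.not_gt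
  rcases i with i | i <;> rcases j with j | j <;>
    simp [pairOf, truncSigma, diagonal_apply, pairIndex, h1, h2, h3, ht]

end TruncSigma

/-- In the Fourier domain both errors are supported on the blocks of ±t, so it suffices to compare
them block by block. The blocks of the competitor are themselves products through r or 2r columns,
and Eckart–Young applies to each. -/
theorem IsTruncatedQTSVD.isMinOn (hμ : IsUnitPure μ) {hr : r < min n₁ n₂} {T : QTensor n₁ n₂ m}
    {Ur : QTensor n₁ r m} {Sr : QTensor r r m} {Vr : QTensor n₂ r m}
    (h : IsTruncatedQTSVD hr μ T Ur Sr Vr) :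
    IsMinOn (fun Z : QTensor n₁ n₂ m => frobNorm (T - Z) ^ 2) (lowRank n₁ n₂ m r)
      (tProd (tProd Ur Sr) (conjT Vr)) := by
  obtain ⟨U₁, σ₁, V₁, U₂, σ₂, V₂, h1, h2, hS, hU, hV⟩ := h
  rintro _ ⟨X, Y, rfl⟩
  have hm : (0 : ℝ) < m := by exact_mod_cast NeZero.pos m
  refine le_of_mul_le_mul_left ?_ hm
  have hF : ∀ Z : QTensor n₁ n₂ m, (m : ℝ) * frobNorm (T - Z) ^ 2 =
      nsq (toFourier μ (bcirc T) - toFourier μ (bcirc Z)) := fun Z => by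
    rw [← nsq_bcirc, ← toFourier_sub, nsq_toFourier hμ]; rfl
  have supp : ∀ {a b : ℕ} (Z : QTensor a b m), IsSupported (toFourier μ (bcirc Z)) := fun Z =>
    (isEquivariant_toFourier_bcirc hμ Z).isSupported hμ
  rw [hF, hF, bcirc_tProd, bcirc_tProd, bcirc_tProd, bcirc_conjT, hS, hU, hV]
  simp only [toFourier_mul hμ, toFourier_conjTranspose, toFourier_fromFourier hμ]
  have hle : r ≤ min n₁ n₂ := hr.le
  have sU := isSupported_truncFactor (hle.trans (min_le_left _ _)) U₁ U₂
  have sS := isSupported_truncSigma hle σ₁ σ₂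
  have sV := isSupported_truncFactor (hle.trans (min_le_right _ _)) V₁ V₂
  refine nsq_le_nsq_of_blocks ((supp T).sub ((sU.mul sS).mul sV.conjTranspose))
    ((supp T).sub ((supp X).mul (supp Y))) (fun t ht => ?_) fun t ht => ?_
  · have bsub : ∀ B : Matrix (Fin m × Fin n₁) (Fin m × Fin n₂) ℍ,
        block (toFourier μ (bcirc T) - B) t t = singleBlock μ T t - block B t t := fun _ => rfl
    rw [bsub, bsub, block_mul (sU.mul sS) _ ht, block_mul sU _ ht, block_mul (supp X) _ ht,
      block_conjTranspose, block_truncFactor _ _ _ ht, block_truncFactor _ _ _ ht,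
      block_truncSigma _ _ _ ht]
    refine nsq_sub_truncation_le hr (h1 t ht) (Fin.castLE_injective _) (fun k => ?_) _ _
    exact ⟨by rintro ⟨j, rfl⟩; exact j.isLt, fun hk => ⟨⟨k, hk⟩, rfl⟩⟩
  · have bsub : ∀ B : Matrix (Fin m × Fin n₁) (Fin m × Fin n₂) ℍ,
        pairOf (toFourier μ (bcirc T) - B) t = pairBlock μ T t - pairOf B t := fun B => by
      rw [pairBlock_eq]; rfl
    rw [bsub, bsub, pairOf_mul (sU.mul sS) _ ht.ne, pairOf_mul sU _ ht.ne,
      pairOf_mul (supp X) _ ht.ne, pairOf_conjTranspose, pairOf_truncFactor _ _ _ ht,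
      pairOf_truncFactor _ _ _ ht, pairOf_truncSigma _ _ _ ht]
    have hc : 2 * r < min (2 * n₁) (2 * n₂) := by omega
    -- Eckart–Young selects columns of both factors through one indexing of the singular values, so
    -- the two column selections are factored through it.
    have e1 : ∀ {n : ℕ} (hn : 2 * r ≤ n) (hn' : min (2 * n₁) (2 * n₂) ≤ n),
        (pairIndex hn : Fin r ⊕ Fin r → Fin n) = Fin.castLE hn' ∘ pairIndex hc.le := by
      intro n hn hn'
      funext g
      rcases g with g | g <;> rfl
    rw [e1 _ (min_le_left _ _), e1 _ (min_le_right _ _)]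
    exact nsq_sub_truncation_le hc (h2 t ht) (pairIndex_injective _) (mem_range_pairIndex _) _ _

lemma tProd_mem_lowRank (Ur : QTensor n₁ r m) (Sr : QTensor r r m)
    (Vr : QTensor n₂ r m) : tProd (tProd Ur Sr) (conjT Vr) ∈ lowRank n₁ n₂ m r :=
  ⟨Ur, tProd Sr (conjT Vr), tProd_assoc _ _ _⟩

end

/-! ### Pair blocks over the centralizer of μ -/

section

section Anticommuting

/-- There is a unit quaternion that anticommutes with a given pure quaternion. -/
lemma exists_anticommuting {μ : ℍ} (hμ : IsUnitPure μ) :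
    ∃ ν : ℍ, star ν * ν = 1 ∧ ν * star ν = 1 ∧ μ * ν = -(ν * μ) := by
  have hex : ∃ q : ℍ, μ * q ≠ q * μ := by
    by_contra! hall
    obtain ⟨i, hi⟩ : ∃ i : ℍ, i.re = 0 ∧ i.imI = 1 ∧ i.imJ = 0 ∧ i.imK = 0 :=
      ⟨⟨0, 1, 0, 0⟩, rfl, rfl, rfl, rfl⟩
    obtain ⟨j, hj⟩ : ∃ j : ℍ, j.re = 0 ∧ j.imI = 0 ∧ j.imJ = 1 ∧ j.imK = 0 :=
      ⟨⟨0, 0, 1, 0⟩, rfl, rfl, rfl, rfl⟩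
    have h1 := congrArg (fun x : ℍ => x.imJ) (hall i)
    have h2 := congrArg (fun x : ℍ => x.imK) (hall i)
    have h3 := congrArg (fun x : ℍ => x.imK) (hall j)
    simp [hi, hj] at h1 h2 h3
    have h0 : μ = 0 := by
      ext
      · exact hμ.1
      · show μ.imI = 0; linarith
      · show μ.imJ = 0; linarith
      · show μ.imK = 0; linarith
    simpa [h0] using hμ.2
  obtain ⟨q, hq⟩ := hex
  -- Because μ² = -1, every commutator with μ anticommutes with μ; a nonzero one exists since μ is
  -- not central.
  set x := μ * q - q * μ with hx
  have hx0 : ‖x‖ ≠ 0 := norm_ne_zero_iff.2 (sub_ne_zero.2 hq)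
  have hanti : μ * x = -(x * μ) := by
    rw [hx, mul_sub, sub_mul, ← mul_assoc, hμ.mul_self, mul_assoc q, hμ.mul_self, mul_assoc]
    simp [sub_eq_add_neg]
  have hn : star (‖x‖⁻¹ • x) * (‖x‖⁻¹ • x) = 1 := by
    rw [star_mul_self_eq_norm_sq, norm_smul, norm_inv, norm_norm, inv_mul_cancel₀ hx0]; simp
  refine ⟨‖x‖⁻¹ • x, hn, ?_, ?_⟩
  · rw [Quaternion.self_mul_star, ← Quaternion.star_mul_self, hn]
  · rw [mul_smul_comm, hanti, smul_mul_assoc, smul_neg]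

variable {m : ℕ} [NeZero m] {μ : ℍ}

/-- A self-conjugate root is real, so equivariance places no restriction on the single blocks and
any SVD can be used there. -/
lemma chi_mul_comm_of_eq_neg (hμ : IsUnitPure μ) {t : Fin m} (ht : t = -t) (q : ℍ) :
    chi μ t * q = q * chi μ t := by
  have h : star (chi μ t) = chi μ t := by rw [star_chi hμ, ← ht]
  rw [Quaternion.star_eq_self] at h
  rw [h, Quaternion.coe_commutes]

lemma exists_chi_eq (hμ : IsUnitPure μ) {t : Fin m} (ht : t ≠ -t) :
    ∃ a b : ℝ, b ≠ 0 ∧ chi μ t = (a : ℍ) + b • μ ∧ chi μ (-t) = (a : ℍ) - b • μ := by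
  obtain ⟨a, b, h⟩ := chi_eq hμ t
  have h' : chi μ (-t) = (a : ℍ) - b • μ := by
    rw [← star_chi hμ, h, star_add, Quaternion.star_coe, Quaternion.star_smul, hμ.star_eq, smul_neg,
      sub_eq_add_neg]
  refine ⟨a, b, ?_, h, h'⟩
  rintro rfl
  exact ht (chi_injective hμ (by rw [h, h']; simp))

/-- For t ≠ -t the root is a + bμ with b ≠ 0, so equivariance reduces to a condition on μ alone. -/
lemma commute_iff_chi (hμ : IsUnitPure μ) {t : Fin m} (ht : t ≠ -t) (q : ℍ) :
    chi μ t * q = q * chi μ t ↔ μ * q = q * μ := by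
  obtain ⟨a, b, hb, h, -⟩ := exists_chi_eq hμ ht
  rw [h, add_mul, mul_add, Quaternion.coe_commutes, add_right_inj, smul_mul_assoc, mul_smul_comm]
  exact (smul_right_injective ℍ hb).eq_iff

lemma anticommute_iff_chi (hμ : IsUnitPure μ) {t : Fin m} (ht : t ≠ -t) (q : ℍ) :
    chi μ t * q = q * chi μ (-t) ↔ μ * q = -(q * μ) := by
  obtain ⟨a, b, hb, h, h'⟩ := exists_chi_eq hμ ht
  rw [h, h', add_mul, mul_sub, Quaternion.coe_commutes, sub_eq_add_neg, add_right_inj,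
    smul_mul_assoc, mul_smul_comm, ← smul_neg]
  exact (smul_right_injective ℍ hb).eq_iff

lemma anticommute_iff_chi_neg (hμ : IsUnitPure μ) {t : Fin m} (ht : t ≠ -t) (q : ℍ) :
    chi μ (-t) * q = q * chi μ t ↔ μ * q = -(q * μ) := by
  have := anticommute_iff_chi hμ (t := -t) (by rw [neg_neg]; exact ht.symm) q
  rwa [neg_neg] at this

end Anticommuting

section PairSVD

variable {n₁ n₂ m : ℕ} [NeZero m] {μ ν : ℍ}

/-- The factor that conjugates the pair blocks into matrices over the centralizer of `μ`. -/
def twist (n : ℕ) (ν : ℍ) : Matrix (Fin n ⊕ Fin n) (Fin n ⊕ Fin n) ℍ :=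
  diagonal (Sum.elim (fun _ => 1) fun _ => ν)

lemma twist_unitary (hν : star ν * ν = 1) (hν' : ν * star ν = 1) (n : ℕ) :
    (twist n ν)ᴴ * twist n ν = 1 ∧ twist n ν * (twist n ν)ᴴ = 1 := by
  rw [twist, diagonal_conjTranspose, diagonal_mul_diagonal, diagonal_mul_diagonal]
  constructor <;> rw [← diagonal_one] <;> congr 1 <;> funext x <;> rcases x with x | x <;>
    simp [hν, hν']

/-- Upper rows commute with `μ`, lower rows anticommute with `μ`. -/
def IsPaired {n : ℕ} {κ : Type} (μ : ℍ) (W : Matrix (Fin n ⊕ Fin n) κ ℍ) : Prop :=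
  (∀ i k, μ * W (Sum.inl i) k = W (Sum.inl i) k * μ) ∧
    ∀ i k, μ * W (Sum.inr i) k = -(W (Sum.inr i) k * μ)

lemma commute_mul {a b : ℍ} (ha : μ * a = -(a * μ)) (hb : μ * b = -(b * μ)) :
    μ * (a * b) = a * b * μ := by
  rw [← mul_assoc, ha, neg_mul, mul_assoc, hb, mul_neg, neg_neg, mul_assoc]

lemma anticommute_star (hμ : IsUnitPure μ) {a : ℍ} (ha : μ * a = -(a * μ)) :
    μ * star a = -(star a * μ) := by
  have := congrArg star ha
  rw [star_mul, star_neg, star_mul, hμ.star_eq, mul_neg, neg_mul, neg_neg] at this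
  exact this.symm

/-- In a pair block the diagonal blocks commute with μ and the off-diagonal ones anticommute.
Conjugation by diag(1, ν) makes all entries commute with μ. An SVD over the centralizer of μ,
twisted back, has factors whose upper rows commute and lower rows anticommute with μ. -/
lemma exists_pair_svd (hμ : IsUnitPure μ) (hν : star ν * ν = 1) (hν' : ν * star ν = 1)
    (hμν : μ * ν = -(ν * μ)) (T : QTensor n₁ n₂ m) {t : Fin m} (ht : t ≠ -t) :
    ∃ (W : Matrix (Fin n₁ ⊕ Fin n₁) (Fin (2 * n₁)) ℍ)
      (Z : Matrix (Fin n₂ ⊕ Fin n₂) (Fin (2 * n₂)) ℍ) (s : Fin (min (2 * n₁) (2 * n₂)) → ℝ),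
      (Wᴴ * W = 1 ∧ W * Wᴴ = 1) ∧ (Zᴴ * Z = 1 ∧ Z * Zᴴ = 1) ∧ IsPaired μ W ∧ IsPaired μ Z ∧
      (∀ k, 0 ≤ s k) ∧ Antitone s ∧ Wᴴ * pairBlock μ T t * Z = rectDiag s := by
  set S := Subalgebra.centralizer ℝ ({μ} : Set ℍ) with hS
  have hmem : ∀ q, q ∈ S ↔ μ * q = q * μ := fun q => by
    simp [hS, Subalgebra.mem_centralizer_iff]
  have hD := isEquivariant_toFourier_bcirc hμ T
  have hνs := anticommute_star hμ hμν
  have hG : EntriesIn S ((twist n₁ ν)ᴴ * pairBlock μ T t * twist n₂ ν) := fun x y => by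
    rw [hmem, pairBlock_eq, twist, twist, diagonal_conjTranspose, mul_diagonal, diagonal_mul]
    rcases x with i | i <;> rcases y with j | j <;>
      simp only [Pi.star_apply, Sum.elim_inl, Sum.elim_inr, star_one, one_mul, mul_one, pairOf,
        submatrix_apply]
    · exact (commute_iff_chi hμ ht _).1 (hD _ _ _ _)
    · exact commute_mul ((anticommute_iff_chi hμ ht _).1 (hD _ _ _ _)) hμν
    · exact commute_mul hνs ((anticommute_iff_chi_neg hμ ht _).1 (hD _ _ _ _))
    · have h1 := (commute_iff_chi hμ (t := -t) (by rw [neg_neg]; exact ht.symm) _).1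
        (hD (-t) (-t) i j)
      rw [mul_assoc]
      refine commute_mul hνs ?_
      rw [← mul_assoc, h1, mul_assoc, hμν, mul_neg, mul_assoc]
  let e : ∀ n, Fin n ⊕ Fin n ≃ Fin (2 * n) := fun n =>
    finSumFinEquiv.trans (finCongr (two_mul n).symm)
  obtain ⟨W, hW, Z, hZ, s, h0, hs, h⟩ := exists_svd (S := S) ((hmem μ).2 rfl) hμ.star_eq
    hμ.star_mul_self (M := ((twist n₁ ν)ᴴ * pairBlock μ T t * twist n₂ ν).submatrix
      (e n₁).symm (e n₂).symm) fun i j => hG _ _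
  have hu : ∀ {n : ℕ} {W : Matrix (Fin (2 * n)) (Fin (2 * n)) ℍ}, W ∈ unitariesIn S _ →
      ((twist n ν * W.submatrix (e n) id)ᴴ * (twist n ν * W.submatrix (e n) id) = 1 ∧
        (twist n ν * W.submatrix (e n) id) * (twist n ν * W.submatrix (e n) id)ᴴ = 1) ∧
      IsPaired μ (twist n ν * W.submatrix (e n) id) := fun {n W} hW => by
    have hW1 : (W.submatrix (e n) id)ᴴ * W.submatrix (e n) id = 1 := by
      rw [conjTranspose_submatrix, submatrix_mul_equiv, hW.2.1, submatrix_id_id]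
    have hW2 : W.submatrix (e n) id * (W.submatrix (e n) id)ᴴ = 1 := by
      rw [conjTranspose_submatrix, ← submatrix_mul _ _ _ id _ Function.bijective_id, hW.2.2,
        submatrix_one_equiv]
    obtain ⟨t1, t2⟩ := twist_unitary hν hν' n
    refine ⟨⟨?_, ?_⟩, fun i k => ?_, fun i k => ?_⟩
    · rw [conjTranspose_mul, Matrix.mul_assoc, ← Matrix.mul_assoc (twist n ν)ᴴ, t1,
        Matrix.one_mul, hW1]
    · rw [conjTranspose_mul, Matrix.mul_assoc, ← Matrix.mul_assoc (W.submatrix (e n) id), hW2,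
        Matrix.one_mul, t2]
    · rw [twist, diagonal_mul, Sum.elim_inl, one_mul]
      exact (hmem _).1 (hW.1 _ _)
    · rw [twist, diagonal_mul, Sum.elim_inr, ← mul_assoc, hμν, submatrix_apply, neg_mul, mul_assoc,
        (hmem _).1 (hW.1 _ _), mul_assoc]
  refine ⟨twist n₁ ν * W.submatrix (e n₁) id, twist n₂ ν * Z.submatrix (e n₂) id, s,
    (hu hW).1, (hu hZ).1, (hu hW).2, (hu hZ).2, h0, hs, ?_⟩
  set G := (twist n₁ ν)ᴴ * pairBlock μ T t * twist n₂ ν with hGdef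
  have e1 : G = (G.submatrix (e n₁).symm (e n₂).symm).submatrix (e n₁) (e n₂) := by
    rw [submatrix_submatrix]; simp
  have e2 : (twist n₁ ν * W.submatrix (e n₁) id)ᴴ * pairBlock μ T t *
      (twist n₂ ν * Z.submatrix (e n₂) id) =
      (W.submatrix (e n₁) id)ᴴ * G * Z.submatrix (e n₂) id := by
    simp only [hGdef, conjTranspose_mul, Matrix.mul_assoc]
  rw [e2, e1, conjTranspose_submatrix, submatrix_mul_equiv, submatrix_mul_equiv, submatrix_id_id, h]

end PairSVD

end

/-! ### Assembling the full T-SVD -/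

section

/-- The permutation of `ℕ` that moves the even numbers below `2 r` to the front and fixes all
numbers from `2 r` on. -/
def deal (r : ℕ) : Equiv.Perm ℕ where
  toFun k := if k < r then 2 * k else if k < 2 * r then 2 * (k - r) + 1 else k
  invFun k := if k < 2 * r then (if k % 2 = 0 then k / 2 else r + k / 2) else k
  left_inv k := by dsimp only; split_ifs <;> omega
  right_inv k := by dsimp only; split_ifs <;> omega

lemma deal_apply (r k : ℕ) :
    deal r k = if k < r then 2 * k else if k < 2 * r then 2 * (k - r) + 1 else k := rfl

lemma deal_lt_iff {r N : ℕ} (h : 2 * r ≤ N) (k : ℕ) : deal r k < N ↔ k < N := by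
  rw [deal_apply]; split_ifs <;> omega

/-- The diagonal matrix that multiplies all columns from `r` on by `star ν`. -/
def phase (r N : ℕ) (ν : ℍ) : Matrix (Fin N) (Fin N) ℍ :=
  diagonal fun k => if k.val < r then 1 else star ν

/-- The columns of `W` in the order `deal r`, those from `r` on multiplied by `star ν`. -/
def dealt {n r : ℕ} {ι : Type} (h : r ≤ n) (ν : ℍ) (W : Matrix ι (Fin (2 * n)) ℍ) :
    Matrix ι (Fin (2 * n)) ℍ :=
  W.submatrix id (permFin (deal r) (deal_lt_iff (Nat.mul_le_mul_left 2 h))) * phase r (2 * n) ν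

section Dealt

variable {n r : ℕ} {ι : Type} (h : r ≤ n) {ν : ℍ} (W : Matrix ι (Fin (2 * n)) ℍ)

lemma dealt_apply_left (i : ι) (j : ℕ) (hj : j < r) (hj' : j < 2 * n) :
    dealt h ν W i ⟨j, hj'⟩ = W i ⟨2 * j, by omega⟩ := by
  simp [dealt, phase, permFin, deal_apply, hj]

lemma dealt_apply_right (i : ι) (j : ℕ) (hj : j < r) (hj' : r + j < 2 * n) :
    dealt h ν W i ⟨r + j, hj'⟩ = W i ⟨2 * j + 1, by omega⟩ * star ν := by
  have h1 : r + j < 2 * r := by omega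
  simp [dealt, phase, permFin, deal_apply, h1]

lemma phase_unitary (hν : star ν * ν = 1) (hν' : ν * star ν = 1) (N : ℕ) :
    (phase r N ν)ᴴ * phase r N ν = 1 ∧ phase r N ν * (phase r N ν)ᴴ = 1 := by
  rw [phase, diagonal_conjTranspose, diagonal_mul_diagonal, diagonal_mul_diagonal, ← diagonal_one]
  constructor <;> congr 1 <;> funext k <;> simp only [Pi.star_apply] <;> split_ifs <;>
    simp [hν, hν']

lemma dealt_unitary [Fintype ι] [DecidableEq ι] (hν : star ν * ν = 1) (hν' : ν * star ν = 1)
    (hW : Wᴴ * W = 1 ∧ W * Wᴴ = 1) :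
    (dealt h ν W)ᴴ * dealt h ν W = 1 ∧ dealt h ν W * (dealt h ν W)ᴴ = 1 := by
  obtain ⟨h1, h2⟩ := conjTranspose_submatrix_mul hW
    (permFin (deal r) (deal_lt_iff (Nat.mul_le_mul_left 2 h)))
  obtain ⟨h3, h4⟩ := phase_unitary (r := r) hν hν' (2 * n)
  constructor
  · rw [dealt, conjTranspose_mul, Matrix.mul_assoc, ← Matrix.mul_assoc (W.submatrix _ _)ᴴ, h1,
      Matrix.one_mul, h3]
  · rw [dealt, conjTranspose_mul, Matrix.mul_assoc, ← Matrix.mul_assoc (phase _ _ _), h4,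
      Matrix.one_mul, h2]

end Dealt

/-- The phases on the two sides match and cancel, because singular values are real and hence
central. -/
lemma phase_mul_rectDiag {p q : ℕ} {ν : ℍ} (hν' : ν * star ν = 1) (r : ℕ)
    (σ : Fin (min p q) → ℝ) : (phase r p ν)ᴴ * rectDiag σ * phase r q ν = rectDiag σ := by
  refine Matrix.ext fun i j => ?_
  rw [phase, phase, diagonal_conjTranspose, mul_diagonal, diagonal_mul]
  simp only [rectDiag, of_apply, Pi.star_apply]
  by_cases hij : i.val = j.val
  · rw [dif_pos hij, ← hij]
    split_ifs
    · simp
    · rw [star_star, ← Quaternion.coe_commutes, mul_assoc, hν', mul_one]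
  · simp [hij]

lemma dealt_conjTranspose_mul_mul_dealt {n₁ n₂ r₁ r₂ : ℕ} {ι κ : Type} [Fintype ι] [Fintype κ]
    (h₁ : r₁ ≤ n₁) (h₂ : r₂ ≤ n₂) (ν : ℍ) {M : Matrix ι κ ℍ} (W : Matrix ι (Fin (2 * n₁)) ℍ)
    (Z : Matrix κ (Fin (2 * n₂)) ℍ) :
    (dealt h₁ ν W)ᴴ * M * dealt h₂ ν Z = (phase r₁ (2 * n₁) ν)ᴴ *
      (Wᴴ * M * Z).submatrix (permFin (deal r₁) (deal_lt_iff (Nat.mul_le_mul_left 2 h₁)))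
        (permFin (deal r₂) (deal_lt_iff (Nat.mul_le_mul_left 2 h₂))) * phase r₂ (2 * n₂) ν := by
  have e : ∀ (a : Fin (2 * n₁) → Fin (2 * n₁)) (b : Fin (2 * n₂) → Fin (2 * n₂)),
      (Wᴴ * M * Z).submatrix a b = (W.submatrix id a)ᴴ * M * Z.submatrix id b :=
    fun _ _ => rfl
  rw [e]
  simp only [dealt, conjTranspose_mul, Matrix.mul_assoc]

lemma isQSVD_dealt {n₁ n₂ r : ℕ} {ι κ : Type} [Fintype ι] [Fintype κ] [DecidableEq ι]
    [DecidableEq κ] (h₁ : r ≤ n₁) (h₂ : r ≤ n₂) {ν : ℍ} (hν : star ν * ν = 1)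
    (hν' : ν * star ν = 1) {M : Matrix ι κ ℍ} {W : Matrix ι (Fin (2 * n₁)) ℍ}
    {Z : Matrix κ (Fin (2 * n₂)) ℍ} {s : Fin (min (2 * n₁) (2 * n₂)) → ℝ}
    (hW : Wᴴ * W = 1 ∧ W * Wᴴ = 1) (hZ : Zᴴ * Z = 1 ∧ Z * Zᴴ = 1) (h0 : ∀ k, 0 ≤ s k)
    (hs : Antitone s) (h : Wᴴ * M * Z = rectDiag s) :
    IsQSVD (2 * r) M (dealt h₁ ν W) (s ∘ permFin (deal r) (deal_lt_iff (by omega)))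
      (dealt h₂ ν Z) where
  left_unitary := dealt_unitary h₁ W hν hν' hW
  right_unitary := dealt_unitary h₂ Z hν hν' hZ
  nonneg k := h0 _
  svd := by
    rw [dealt_conjTranspose_mul_mul_dealt, h, rectDiag_submatrix, phase_mul_rectDiag hν']
  -- `deal r` permutes the positions below 2r among themselves and fixes the rest, so sortedness of
  -- s is enough.
  largest k l hk hl := by
    refine hs (Fin.le_def.2 ?_)
    simp only [permFin, Equiv.coe_fn_mk, deal_apply]
    split_ifs <;> omega

section Full

variable {n n₁ n₂ m r : ℕ} [NeZero m] {μ ν : ℍ}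

/-- For a representative t < -t and every r, column j of block column t comes from sorted component
2j and column j of block column -t from 2j + 1. As this does not depend on r, the truncations are
nested. -/
lemma truncFactor_dealt (h : r ≤ n) (U₁ : Fin m → Matrix (Fin n) (Fin n) ℍ)
    (W : Fin m → Matrix (Fin n ⊕ Fin n) (Fin (2 * n)) ℍ) :
    truncFactor h U₁ (fun t => dealt h ν (W t)) =
      (truncFactor le_rfl U₁ fun t => dealt le_rfl ν (W t)).submatrix id
        (Prod.map id (Fin.castLE h)) := by
  refine Matrix.ext fun ⟨s, i⟩ ⟨t, j⟩ => ?_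
  have hj : j.val < n := j.isLt.trans_le h
  simp only [truncFactor, of_apply, submatrix_apply, id, Prod.map_apply, Fin.val_castLE,
    dealt_apply_left h _ _ _ j.isLt, dealt_apply_right h _ _ _ j.isLt,
    dealt_apply_left le_rfl _ _ _ hj, dealt_apply_right le_rfl _ _ _ hj]

/-- In the block column -t of a pair, the upper rows have to anticommute with μ and the lower ones
to commute, the reverse of `IsPaired`. The factor star ν exchanges the two conditions. -/
lemma isEquivariant_truncFactor_dealt (hμ : IsUnitPure μ) (hμν : μ * ν = -(ν * μ))
    (U₁ : Fin m → Matrix (Fin n) (Fin n) ℍ)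
    {W : Fin m → Matrix (Fin n ⊕ Fin n) (Fin (2 * n)) ℍ} (hW : ∀ t, t < -t → IsPaired μ (W t)) :
    IsEquivariant μ (truncFactor le_rfl U₁ fun t => dealt le_rfl ν (W t)) := by
  intro s t i j
  have hνs := anticommute_star hμ hμν
  by_cases hst : s = t ∨ s = -t
  · rcases lt_trichotomy_neg t with h | h | h
    · rw [← h, or_self] at hst
      subst hst
      exact chi_mul_comm_of_eq_neg hμ h _
    · have h1 : t ≠ -t := h.ne
      have h2 : -t ≠ t := h.ne'
      rcases hst with rfl | rfl
      · simp only [truncFactor, of_apply, if_neg h1, if_pos h, if_true,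
          dealt_apply_left le_rfl _ _ _ j.isLt]
        exact (commute_iff_chi hμ h1 _).2 ((hW _ h).1 _ _)
      · simp only [truncFactor, of_apply, if_neg h1, if_pos h, if_true, if_neg h2,
          dealt_apply_left le_rfl _ _ _ j.isLt]
        exact (anticommute_iff_chi_neg hμ h1 _).2 ((hW _ h).2 _ _)
    · have h' : -t < t := by rwa [neg_neg] at h
      have h1 : t ≠ -t := h'.ne'
      have h2 : ¬ t < -t := h'.not_gt
      rcases hst with rfl | rfl
      · simp only [truncFactor, of_apply, if_neg h1, if_neg h2, if_true,
          dealt_apply_right le_rfl _ _ _ j.isLt]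
        exact (commute_iff_chi hμ h1 _).2 (commute_mul ((hW _ h).2 _ _) hνs)
      · simp only [truncFactor, of_apply, if_neg h1, if_neg h2, if_true,
          dealt_apply_right le_rfl _ _ _ j.isLt]
        refine (anticommute_iff_chi_neg hμ h1 _).2 ?_
        rw [← mul_assoc, (hW _ h).1, mul_assoc, hνs, mul_neg, mul_assoc]
  · rw [not_or] at hst
    rw [isSupported_truncFactor le_rfl _ _ s t i j hst.1 hst.2, mul_zero, zero_mul]

/-- `pairIndex` as an equivalence if all components are kept. -/
def pairEquiv (n : ℕ) : Fin n ⊕ Fin n ≃ Fin (2 * n) :=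
  Equiv.ofBijective (pairIndex (r := n) le_rfl) ⟨pairIndex_injective _, fun k =>
    (mem_range_pairIndex le_rfl k).2 k.isLt⟩

lemma block_one {t : Fin m} : block (1 : Matrix (Fin m × Fin n) (Fin m × Fin n) ℍ) t t = 1 := by
  refine Matrix.ext fun i j => ?_
  simp [block, one_apply]

lemma pairOf_one {t : Fin m} (ht : t ≠ -t) :
    pairOf (1 : Matrix (Fin m × Fin n) (Fin m × Fin n) ℍ) t = 1 := by
  refine Matrix.ext fun i j => ?_
  rcases i with i | i <;> rcases j with j | j <;> simp [pairOf, one_apply, ht, ht.symm]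

lemma truncFactor_unitary {U₁ : Fin m → Matrix (Fin n) (Fin n) ℍ}
    {U₂ : Fin m → Matrix (Fin n ⊕ Fin n) (Fin (2 * n)) ℍ}
    (h₁ : ∀ t, t = -t → (U₁ t)ᴴ * U₁ t = 1 ∧ U₁ t * (U₁ t)ᴴ = 1)
    (h₂ : ∀ t, t < -t → (U₂ t)ᴴ * U₂ t = 1 ∧ U₂ t * (U₂ t)ᴴ = 1) :
    (truncFactor le_rfl U₁ U₂)ᴴ * truncFactor le_rfl U₁ U₂ = 1 ∧
      truncFactor le_rfl U₁ U₂ * (truncFactor le_rfl U₁ U₂)ᴴ = 1 := by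
  have sU := isSupported_truncFactor le_rfl U₁ U₂
  have hb : ∀ t, t = -t → block (truncFactor le_rfl U₁ U₂) t t = U₁ t := fun t ht => by
    rw [block_truncFactor _ _ _ ht]; rfl
  have hp : ∀ t, t < -t → pairOf (truncFactor le_rfl U₁ U₂) t =
      (U₂ t).submatrix id (pairEquiv n) := fun t ht => pairOf_truncFactor _ _ _ ht
  constructor
  · refine ext_of_blocks (sU.conjTranspose.mul sU) .one (fun t ht => ?_) fun t ht => ?_
    · rw [block_mul sU.conjTranspose _ ht, block_conjTranspose, hb t ht, (h₁ t ht).1, block_one]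
    · rw [pairOf_mul sU.conjTranspose _ ht.ne, pairOf_conjTranspose, hp t ht, pairOf_one ht.ne]
      exact (conjTranspose_submatrix_mul (h₂ t ht) _).1
  · refine ext_of_blocks (sU.mul sU.conjTranspose) .one (fun t ht => ?_) fun t ht => ?_
    · rw [block_mul sU _ ht, block_conjTranspose, hb t ht, (h₁ t ht).2, block_one]
    · rw [pairOf_mul sU _ ht.ne, pairOf_conjTranspose, hp t ht, pairOf_one ht.ne]
      exact (conjTranspose_submatrix_mul (h₂ t ht) _).2

/-- The untruncated middle factor: the singular values of a pair block are distributed alternately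
to its two frequencies. -/
def fullSigma (σ₁ : Fin m → Fin (min n₁ n₂) → ℝ) (s : Fin m → Fin (min (2 * n₁) (2 * n₂)) → ℝ) :
    Matrix (Fin m × Fin n₁) (Fin m × Fin n₂) ℍ :=
  of fun a b => if a.1 = b.1 then
    rectDiag (fun k => if b.1 = -b.1 then σ₁ b.1 k
      else if b.1 < -b.1 then s b.1 ⟨2 * k, by omega⟩
      else s (-b.1) ⟨2 * k + 1, by omega⟩) a.2 b.2 else 0

lemma isSupported_fullSigma (σ₁ : Fin m → Fin (min n₁ n₂) → ℝ)
    (s : Fin m → Fin (min (2 * n₁) (2 * n₂)) → ℝ) : IsSupported (fullSigma σ₁ s) :=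
  fun s t i j h _ => by simp [fullSigma, h]

lemma fullSigma_eq_zero (σ₁ : Fin m → Fin (min n₁ n₂) → ℝ)
    (s : Fin m → Fin (min (2 * n₁) (2 * n₂)) → ℝ) (a : Fin m × Fin n₁) (b : Fin m × Fin n₂)
    (h : a.2.val ≠ b.2.val) : fullSigma σ₁ s a b = 0 := by
  simp [fullSigma, rectDiag, h]

lemma truncSigma_eq_submatrix (h : r ≤ min n₁ n₂) (σ₁ : Fin m → Fin (min n₁ n₂) → ℝ)
    (s : Fin m → Fin (min (2 * n₁) (2 * n₂)) → ℝ) :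
    truncSigma h σ₁ (fun t => s t ∘ permFin (deal r) (deal_lt_iff (by omega))) =
      (fullSigma σ₁ s).submatrix (Prod.map id (Fin.castLE (h.trans (min_le_left _ _))))
        (Prod.map id (Fin.castLE (h.trans (min_le_right _ _)))) := by
  refine Matrix.ext fun ⟨u, i⟩ ⟨t, j⟩ => ?_
  simp only [truncSigma, diagonal_apply, fullSigma, submatrix_apply, of_apply, Prod.map_apply, id,
    Prod.mk.injEq, rectDiag, Fin.val_castLE, Fin.val_inj]
  by_cases hu : u = t
  · subst hu
    by_cases hij : i = j
    · subst hij
      have h1 : r + i.val < 2 * r := by omega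
      simp only [and_self, if_true, dite_true, Function.comp_apply, permFin, Equiv.coe_fn_mk,
        deal_apply, i.isLt, h1, not_lt.2 (Nat.le_add_right r i.val), if_false,
        Nat.add_sub_cancel_left]
      split_ifs <;> rfl
    · simp [hij]
  · simp [hu]

lemma fromFourier_submatrix {a b a' b' : ℕ} (A : Matrix (Fin m × Fin a) (Fin m × Fin b) ℍ)
    (f : Fin a' → Fin a) (g : Fin b' → Fin b) :
    fromFourier μ (A.submatrix (Prod.map id f) (Prod.map id g)) =
      (fromFourier μ A).submatrix (Prod.map id f) (Prod.map id g) := by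
  refine Matrix.ext fun ⟨u, i⟩ ⟨v, j⟩ => ?_
  rw [submatrix_apply, Prod.map_apply, Prod.map_apply, fromFourier_apply, fromFourier_apply]
  rfl

/-- At full size the dealing sends the i-th index of t to 2i and that of -t to 2i + 1, on rows and
columns alike even if n₁ ≠ n₂. Parity therefore kills the off-diagonal blocks, and the phase cancels
in the block of -t. -/
lemma fullSigma_eq (hν' : ν * star ν = 1) {T : QTensor n₁ n₂ m}
    {U₁ : Fin m → Matrix (Fin n₁) (Fin n₁) ℍ} {V₁ : Fin m → Matrix (Fin n₂) (Fin n₂) ℍ}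
    {σ₁ : Fin m → Fin (min n₁ n₂) → ℝ}
    {W : Fin m → Matrix (Fin n₁ ⊕ Fin n₁) (Fin (2 * n₁)) ℍ}
    {Z : Fin m → Matrix (Fin n₂ ⊕ Fin n₂) (Fin (2 * n₂)) ℍ}
    {s : Fin m → Fin (min (2 * n₁) (2 * n₂)) → ℝ} (hμ : IsUnitPure μ)
    (h₁ : ∀ t, t = -t → (U₁ t)ᴴ * singleBlock μ T t * V₁ t = rectDiag (σ₁ t))
    (h₂ : ∀ t, t < -t → (W t)ᴴ * pairBlock μ T t * Z t = rectDiag (s t)) :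
    (truncFactor le_rfl U₁ fun t => dealt le_rfl ν (W t))ᴴ * toFourier μ (bcirc T) *
      (truncFactor le_rfl V₁ fun t => dealt le_rfl ν (Z t)) = fullSigma σ₁ s := by
  have sU := isSupported_truncFactor le_rfl U₁ fun t => dealt le_rfl ν (W t)
  have sV := isSupported_truncFactor le_rfl V₁ fun t => dealt le_rfl ν (Z t)
  have sT := (isEquivariant_toFourier_bcirc hμ T).isSupported hμ
  refine ext_of_blocks ((sU.conjTranspose.mul sT).mul sV) (isSupported_fullSigma _ _)
    (fun t ht => ?_) fun t ht => ?_
  · rw [block_mul (sU.conjTranspose.mul sT) _ ht, block_mul sU.conjTranspose _ ht,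
      block_conjTranspose, block_truncFactor _ _ _ ht, block_truncFactor _ _ _ ht]
    refine (h₁ t ht).trans (Matrix.ext fun i j => ?_)
    simp [block, fullSigma, ← ht]
  · rw [pairOf_mul (sU.conjTranspose.mul sT) _ ht.ne, pairOf_mul sU.conjTranspose _ ht.ne,
      pairOf_conjTranspose, pairOf_truncFactor _ _ _ ht, pairOf_truncFactor _ _ _ ht,
      ← pairBlock_eq]
    have key : ∀ x y, (((dealt le_rfl ν (W t)).submatrix id (pairIndex le_rfl))ᴴ * pairBlock μ T t *
        (dealt le_rfl ν (Z t)).submatrix id (pairIndex le_rfl)) x y =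
        (Sum.elim (fun _ => 1) (fun _ => ν) x : ℍ) *
          rectDiag (s t) (permFin (deal n₁) (deal_lt_iff le_rfl) (pairIndex le_rfl x))
            (permFin (deal n₂) (deal_lt_iff le_rfl) (pairIndex le_rfl y)) *
          (Sum.elim (fun _ => 1) (fun _ => star ν) y : ℍ) := fun x y => by
      have e := dealt_conjTranspose_mul_mul_dealt le_rfl le_rfl ν (M := pairBlock μ T t) (W t) (Z t)
      rw [h₂ t ht] at e
      refine (congrFun (congrFun e (pairIndex le_rfl x)) (pairIndex le_rfl y)).trans ?_
      rw [phase, phase, diagonal_conjTranspose, mul_diagonal, diagonal_mul, submatrix_apply]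
      rcases x with i | i <;> rcases y with j | j <;> simp [pairIndex]
    refine Matrix.ext fun x y => (key x y).trans ?_
    have h1 : t ≠ -t := ht.ne
    have h2 : -t ≠ t := ht.ne'
    have h3 : ¬ -t < t := ht.not_gt
    have hL : ∀ {n : ℕ} (i : Fin n), permFin (deal n) (deal_lt_iff le_rfl)
        (pairIndex le_rfl (Sum.inl i)) = ⟨2 * i.val, by omega⟩ := fun i =>
      Fin.ext (by simp [permFin, pairIndex, deal_apply])
    have hR : ∀ {n : ℕ} (i : Fin n), permFin (deal n) (deal_lt_iff le_rfl)
        (pairIndex le_rfl (Sum.inr i)) = ⟨2 * i.val + 1, by omega⟩ := fun i =>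
      Fin.ext (by simp [permFin, pairIndex, deal_apply])
    rcases x with i | i <;> rcases y with j | j
    · simp [hL, pairOf, fullSigma, rectDiag, h1, ht]
    · have : 2 * i.val ≠ 2 * j.val + 1 := by omega
      simp [hL, hR, pairOf, fullSigma, rectDiag, h1, this]
    · have : 2 * i.val + 1 ≠ 2 * j.val := by omega
      simp [hL, hR, pairOf, fullSigma, rectDiag, h2, this]
    · by_cases hij : i.val = j.val
      · simp [hR, pairOf, fullSigma, rectDiag, h2, h3, hij, ← Quaternion.coe_commutes, mul_assoc,
          hν']
      · simp [hR, pairOf, fullSigma, rectDiag, hij]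

theorem exists_qtsvd (hμ : IsUnitPure μ) (T : QTensor n₁ n₂ m) :
    ∃ (U : QTensor n₁ n₁ m) (S : QTensor n₁ n₂ m) (V : QTensor n₂ n₂ m), IsQTSVD T U S V ∧
      ∀ (r : ℕ) (hr : r < min n₁ n₂),
        IsTruncatedQTSVD hr μ T (firstCols (hr.le.trans (min_le_left _ _)) U)
          (leading (hr.le.trans (min_le_left _ _)) (hr.le.trans (min_le_right _ _)) S)
          (firstCols (hr.le.trans (min_le_right _ _)) V) := by
  obtain ⟨ν, hν, hν', hμν⟩ := exists_anticommuting hμ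
  have hsingle : ∀ t : Fin m, ∃ (U₁ : Matrix (Fin n₁) (Fin n₁) ℍ) (V₁ : Matrix (Fin n₂) (Fin n₂) ℍ)
      (σ₁ : Fin (min n₁ n₂) → ℝ), (U₁ᴴ * U₁ = 1 ∧ U₁ * U₁ᴴ = 1) ∧ (V₁ᴴ * V₁ = 1 ∧ V₁ * V₁ᴴ = 1) ∧
      (∀ k, 0 ≤ σ₁ k) ∧ Antitone σ₁ ∧ U₁ᴴ * singleBlock μ T t * V₁ = rectDiag σ₁ := fun t => by
    obtain ⟨U, hU, V, hV, σ, h⟩ := exists_svd (S := ⊤) (μ := μ) trivial hμ.star_eq hμ.star_mul_self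
      (M := singleBlock μ T t) fun _ _ => trivial
    exact ⟨U, V, σ, hU.2, hV.2, h⟩
  have hpair : ∀ t : Fin m, ∃ (W : Matrix (Fin n₁ ⊕ Fin n₁) (Fin (2 * n₁)) ℍ)
      (Z : Matrix (Fin n₂ ⊕ Fin n₂) (Fin (2 * n₂)) ℍ) (s : Fin (min (2 * n₁) (2 * n₂)) → ℝ),
      t < -t → (Wᴴ * W = 1 ∧ W * Wᴴ = 1) ∧ (Zᴴ * Z = 1 ∧ Z * Zᴴ = 1) ∧ IsPaired μ W ∧
      IsPaired μ Z ∧ (∀ k, 0 ≤ s k) ∧ Antitone s ∧ Wᴴ * pairBlock μ T t * Z = rectDiag s :=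
    fun t => by
      by_cases ht : t < -t
      · obtain ⟨W, Z, s, h⟩ := exists_pair_svd hμ hν hν' hμν T ht.ne
        exact ⟨W, Z, s, fun _ => h⟩
      · exact ⟨0, 0, 0, fun h => absurd h ht⟩
  choose U₁ V₁ σ₁ hU₁ hV₁ hσ₁ hσ₁' h₁ using hsingle
  choose W Z s hp using hpair
  obtain ⟨U, hU⟩ := (isEquivariant_truncFactor_dealt hμ hμν U₁
    fun t ht => (hp t ht).2.2.1).exists_bcirc_eq hμ
  obtain ⟨V, hV⟩ := (isEquivariant_truncFactor_dealt hμ hμν V₁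
    fun t ht => (hp t ht).2.2.2.1).exists_bcirc_eq hμ
  have hfull := fullSigma_eq hν' hμ (T := T) (fun t _ => h₁ t) fun t ht => (hp t ht).2.2.2.2.2.2
  have hUu := truncFactor_unitary (fun t _ => hU₁ t)
    fun t ht => dealt_unitary le_rfl (W t) hν hν' (hp t ht).1
  have hVu := truncFactor_unitary (fun t _ => hV₁ t)
    fun t ht => dealt_unitary le_rfl (Z t) hν hν' (hp t ht).2.1
  have unit : ∀ {n : ℕ} {Q : QTensor n n m} {A : Matrix (Fin m × Fin n) (Fin m × Fin n) ℍ},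
      bcirc Q = fromFourier μ A → Aᴴ * A = 1 ∧ A * Aᴴ = 1 → IsUnitary Q := by
    intro n Q A hQ hA
    constructor <;> refine bcirc_injective (toFourier_injective hμ ?_)
    · rw [bcirc_tProd, bcirc_conjT, hQ, toFourier_mul hμ, toFourier_conjTranspose,
        toFourier_fromFourier hμ, bcirc_idTensor, toFourier_one hμ, hA.1]
    · rw [bcirc_tProd, bcirc_conjT, hQ, toFourier_mul hμ, toFourier_conjTranspose,
        toFourier_fromFourier hμ, bcirc_idTensor, toFourier_one hμ, hA.2]
  have uU := unit hU hUu
  have uV := unit hV hVu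
  have hS : bcirc (tProd (tProd (conjT U) T) V) = fromFourier μ (fullSigma σ₁ s) := by
    rw [← fromFourier_toFourier hμ (bcirc _), bcirc_tProd, bcirc_tProd, bcirc_conjT, hU, hV,
      toFourier_mul hμ, toFourier_mul hμ, toFourier_conjTranspose, toFourier_fromFourier hμ,
      toFourier_fromFourier hμ, hfull]
  -- With S = U* ⋆ T ⋆ V, the factorization follows from unitarity alone. The slices of S are
  -- diagonal because the inverse transform combines only entries in the same position (i, j) of the
  -- blocks.
  refine ⟨U, tProd (tProd (conjT U) T) V, V, ⟨uU, uV, fun i j k hij => ?_, ?_⟩, fun r hr => ?_⟩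
  · have h := congrFun (congrFun hS (k, i)) (0, j)
    rw [bcirc_apply, sub_zero] at h
    refine h.trans ?_
    rw [fromFourier_apply]
    refine Finset.sum_eq_zero fun _ _ => Finset.sum_eq_zero fun _ _ => ?_
    rw [fullSigma_eq_zero _ _ _ _ hij, mul_zero, zero_mul]
  · have h1 := congrArg bcirc uU.2
    have h2 := congrArg bcirc uV.2
    rw [bcirc_tProd, bcirc_idTensor] at h1 h2
    refine bcirc_injective ?_
    simp only [bcirc_tProd]
    rw [Matrix.mul_assoc, Matrix.mul_assoc _ (bcirc V), h2, Matrix.mul_one, ← Matrix.mul_assoc, h1,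
      Matrix.one_mul]
  · have hle₁ : r ≤ n₁ := hr.le.trans (min_le_left _ _)
    have hle₂ : r ≤ n₂ := hr.le.trans (min_le_right _ _)
    refine ⟨U₁, σ₁, V₁, fun t => dealt hle₁ ν (W t),
      fun t => s t ∘ permFin (deal r) (deal_lt_iff (by omega)), fun t => dealt hle₂ ν (Z t),
      fun t _ => ⟨hU₁ t, hV₁ t, hσ₁ t, h₁ t, fun k l hk hl => hσ₁' t (Fin.le_def.2 (by omega))⟩,
      fun t ht => ?_, ?_, ?_, ?_⟩
    · obtain ⟨hW, hZ, -, -, h0, hs, h⟩ := hp t ht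
      exact isQSVD_dealt hle₁ hle₂ hν hν' hW hZ h0 hs h
    · rw [truncSigma_eq_submatrix, fromFourier_submatrix, ← hS]; rfl
    · rw [truncFactor_dealt]
      refine Eq.trans ?_ (fromFourier_submatrix _ id _).symm
      rw [← hU]; rfl
    · rw [truncFactor_dealt]
      refine Eq.trans ?_ (fromFourier_submatrix _ id _).symm
      rw [← hV]; rfl

end Full

end

end QTensor

end

theorem mainTheorem4 {n₁ n₂ m : ℕ} [NeZero m] (μ : Quaternion ℝ) (hμ : QTensor.IsUnitPure μ)
    (T : QTensor n₁ n₂ m) :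
    (∃ (U : QTensor n₁ n₁ m) (S : QTensor n₁ n₂ m) (V : QTensor n₂ n₂ m),
      QTensor.IsQTSVD T U S V ∧
      ∀ (r : ℕ) (hr : r < min n₁ n₂),
        QTensor.IsTruncatedQTSVD hr μ T
          (QTensor.firstCols (hr.le.trans (min_le_left _ _)) U)
          (QTensor.leading (hr.le.trans (min_le_left _ _)) (hr.le.trans (min_le_right _ _)) S)
          (QTensor.firstCols (hr.le.trans (min_le_right _ _)) V)) ∧
    ∀ (r : ℕ) (hr : r < min n₁ n₂)
      (Ur : QTensor n₁ r m) (Sr : QTensor r r m) (Vr : QTensor n₂ r m),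
      QTensor.IsTruncatedQTSVD hr μ T Ur Sr Vr →
        QTensor.tProd (QTensor.tProd Ur Sr) (QTensor.conjT Vr) ∈ QTensor.lowRank n₁ n₂ m r ∧
        IsMinOn (fun Z : QTensor n₁ n₂ m => QTensor.frobNorm (T - Z) ^ 2)
          (QTensor.lowRank n₁ n₂ m r)
          (QTensor.tProd (QTensor.tProd Ur Sr) (QTensor.conjT Vr)) :=
  ⟨QTensor.exists_qtsvd hμ T, fun _ _ Ur Sr Vr h =>
    ⟨QTensor.tProd_mem_lowRank Ur Sr Vr, h.isMinOn hμ⟩⟩
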